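/- Let $G$ be a compact Hausdorff group with normalized (regular) Haar measure $m_G$, and let $\Phi:[0,\infty)\to[0,\infty)$ be a (finite-valued) Young function, i.e. $\Phi$ is convex, $\Phi(0)=0$ and $\Phi(x)\to\infty$ as $x\to\infty$. Assume that $\Phi$ satisfies the $\Delta_2$-condition: there are $K>0$, $x_0>0$ with $\Phi(2x)\le K\Phi(x)$ for all $x\ge x_0$. Let $L^\Phi(G)$ be the Orlicz space of (classes modulo $m_G$-null functions of) complex measurable functions $f$ on $G$ with $\|f\|_\Phi:=\inf\{k>0:\int_G\Phi(|f|/k)\,dm_G\le 1\}<\infty$, with the norm $\|\cdot\|_\Phi$. Let $\mu$ be a bounded complex Radon measure on $G$ with total variation norm $\|\mu\|=|\mu|(G)$ and with $\mu(G)\neq0$. Then convolution $T_{\Phi,\mu}f=\mu*f$, $(\mu*f)(t)=\int_G f(s^{-1}t)\,d\mu(s)$ (the integral converging absolutely for $m_G$-almost every $t$), is a bounded linear operator on $L^\Phi(G)$, and $\nu_{\Phi,\mu}(A)=T_{\Phi,\mu}(\chi_A)$, for Borel sets $A\subseteq G$, defines a $\sigma$-additive vector measure $\nu=\nu_{\Phi,\mu}$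 with values in $X=L^\Phi(G)$. For $x'$ in the dual $X'$ write $\langle\nu,x'\rangle$ for the complex measure $A\mapsto\langle\nu(A),x'\rangle$, and for measurable $f$ put $$\|f\|_{\nu}=\sup_{x'\in X',\ \|x'\|\le1}\int_G|f|\,d|\langle\nu,x'\rangle| .$$ Let $L^1(\nu)$ be the space, with the norm $\|\cdot\|_\nu$, of (classes modulo $\nu$-null functions of) measurable $f:G\to\mathbb{C}$ that are $\nu$-integrable: $f\in L^1(|\langle\nu,x'\rangle|)$ for all $x'\in X'$, and for every Borel set $A$ there is a (necessarily unique) $x_A\in X$ with $\int_A f\,d\langle\nu,x'\rangle=\langle x_A,x'\rangle$ for all $x'\in X'$. Then: (i) If $f\in L^\Phi(G)$, then $\|f\|_{\nu_{\Phi,\mu}}\le\|f\|_\Phi\,\|\mu\|$. (ii) Every $f\in L^\Phi(G)$ belongs to $L^1(\nu_{\Phi,\mu})$; the inclusion $\imath:L^\Phi(G)\to L^1(\nu_{\Phi,\mu})$ is well defined on classes, injective, linear and continuous, and its operator norm satisfies $|\mu(G)|\le\|\imath\|\le\|\mu\|$. -/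

import Mathlib

open MeasureTheory Filter Topology Set
open scoped ENNReal NNReal

namespace OrliczConv

/-! ### Young functions and Orlicz spaces -/

/-- A (finite-valued) Young function: a convex function `Φ : [0,∞) → [0,∞)` with `Φ 0 = 0` and
`Φ x → ∞` as `x → ∞`. -/
structure YoungFunction where
  toFun : ℝ≥0 → ℝ≥0
  convex' : ConvexOn ℝ≥0 univ toFun
  map_zero' : toFun 0 = 0
  tendsto' : Tendsto toFun atTop atTop

instance : CoeFun YoungFunction (fun _ => ℝ≥0 → ℝ≥0) := ⟨YoungFunction.toFun⟩

/-- The `Δ₂`-condition: `Φ (2x) ≤ K Φ x` for all `x ≥ x₀`. -/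
def YoungFunction.DeltaTwo (Φ : YoungFunction) : Prop :=
  ∃ K x₀ : ℝ≥0, 0 < K ∧ 0 < x₀ ∧ ∀ x, x₀ ≤ x → Φ (2 * x) ≤ K * Φ x

theorem YoungFunction.map_mul_le (Φ : YoungFunction) {a : ℝ≥0} (ha : a ≤ 1) (x : ℝ≥0) :
    Φ (a * x) ≤ a * Φ x := by
  have h := Φ.convex'.2 (mem_univ x) (mem_univ (0 : ℝ≥0)) (zero_le : 0 ≤ a)
    (zero_le : 0 ≤ 1 - a) (add_tsub_cancel_of_le ha)
  simpa [Φ.map_zero'] using h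

theorem YoungFunction.mono (Φ : YoungFunction) : Monotone Φ := by
  intro x y hxy
  rcases eq_or_ne y 0 with rfl | hy
  · rw [nonpos_iff_eq_zero.1 hxy]
  have h1 : x / y ≤ 1 := div_le_one_of_le₀ hxy zero_le
  have h := Φ.map_mul_le h1 y
  rw [div_mul_cancel₀ _ hy] at h
  exact h.trans (mul_le_of_le_one_left zero_le h1)

theorem YoungFunction.measurable (Φ : YoungFunction) : Measurable Φ := Φ.mono.measurable

section Orlicz

variable {α : Type*} [MeasurableSpace α]

/-- The modular `∫ Φ(|f| / k) dm`. -/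
noncomputable def modular (Φ : YoungFunction) (m : Measure α) (f : α → ℂ) (k : ℝ≥0) : ℝ≥0∞ :=
  ∫⁻ x, (Φ (‖f x‖₊ / k) : ℝ≥0∞) ∂m

/-- The Luxemburg norm `inf {k > 0 : ∫ Φ(|f| / k) dm ≤ 1}`, as an element of `[0,∞]`. -/
noncomputable def luxemburg (Φ : YoungFunction) (m : Measure α) (f : α → ℂ) : ℝ≥0∞ :=
  ⨅ (k : ℝ≥0) (_ : 0 < k ∧ modular Φ m f k ≤ 1), (k : ℝ≥0∞)

variable {Φ : YoungFunction} {m : Measure α}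

theorem luxemburg_congr {f g : α → ℂ} (h : f =ᵐ[m] g) : luxemburg Φ m f = luxemburg Φ m g := by
  have : ∀ k, modular Φ m f k = modular Φ m g k := fun k =>
    lintegral_congr_ae (h.mono fun x hx => by simp only [hx])
  simp only [luxemburg, this]

theorem luxemburg_le {f : α → ℂ} {k : ℝ≥0} (hk : 0 < k) (h : modular Φ m f k ≤ 1) :
    luxemburg Φ m f ≤ k := iInf₂_le k ⟨hk, h⟩

theorem exists_of_luxemburg_lt {f : α → ℂ} {a : ℝ≥0∞} (h : luxemburg Φ m f < a) :
    ∃ k : ℝ≥0, 0 < k ∧ modular Φ m f k ≤ 1 ∧ (k : ℝ≥0∞) < a := by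
  simp only [luxemburg, iInf_lt_iff] at h
  obtain ⟨k, ⟨h1, h2⟩, h3⟩ := h
  exact ⟨k, h1, h2, h3⟩

theorem luxemburg_zero : luxemburg Φ m (fun _ => 0) = 0 := by
  refine le_antisymm (ENNReal.le_of_forall_pos_le_add fun ε hε _ => ?_) zero_le
  simpa using luxemburg_le (Φ := Φ) (m := m) (f := fun _ => 0) hε
    (by simp [modular, Φ.map_zero'])

theorem luxemburg_const_mul_le (c : ℂ) (f : α → ℂ) :
    luxemburg Φ m (fun x => c * f x) ≤ ‖c‖₊ * luxemburg Φ m f := by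
  rcases eq_or_ne c 0 with rfl | hc
  · simp [luxemburg_zero]
  have hc' : (0 : ℝ≥0) < ‖c‖₊ := nnnorm_pos.2 hc
  simp only [luxemburg, ENNReal.mul_iInf_of_ne (ENNReal.coe_ne_zero.2 hc'.ne') ENNReal.coe_ne_top]
  refine le_iInf₂ fun k hk => ?_
  refine (luxemburg_le (Φ := Φ) (m := m) (mul_pos hc' hk.1) ?_).trans_eq (by simp)
  refine le_trans (le_of_eq ?_) hk.2
  refine lintegral_congr fun x => ?_
  simp only [nnnorm_mul]
  rw [mul_div_mul_left _ _ hc'.ne']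

theorem luxemburg_const_mul (c : ℂ) (f : α → ℂ) :
    luxemburg Φ m (fun x => c * f x) = ‖c‖₊ * luxemburg Φ m f := by
  refine le_antisymm (luxemburg_const_mul_le c f) ?_
  rcases eq_or_ne c 0 with rfl | hc
  · simp
  have h := luxemburg_const_mul_le (Φ := Φ) (m := m) c⁻¹ (fun x => c * f x)
  simp only [inv_mul_cancel_left₀ hc] at h
  calc (‖c‖₊ : ℝ≥0∞) * luxemburg Φ m f
      ≤ ‖c‖₊ * (‖c⁻¹‖₊ * luxemburg Φ m (fun x => c * f x)) := by gcongr
    _ = luxemburg Φ m (fun x => c * f x) := by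
      rw [← mul_assoc, ← ENNReal.coe_mul, ← nnnorm_mul, mul_inv_cancel₀ hc]; simp

theorem luxemburg_add_le {f g : α → ℂ} (hf : AEMeasurable f m) :
    luxemburg Φ m (fun x => f x + g x) ≤ luxemburg Φ m f + luxemburg Φ m g := by
  refine ENNReal.le_of_forall_pos_le_add fun ε hε hfin => ?_
  obtain ⟨hf1, hg1⟩ := ENNReal.add_lt_top.1 hfin
  have hε2 : ((ε / 2 : ℝ≥0) : ℝ≥0∞) ≠ 0 := by simpa using (half_pos hε).ne'
  obtain ⟨a, ha, ha1, ha2⟩ := exists_of_luxemburg_lt (ENNReal.lt_add_right hf1.ne hε2)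
  obtain ⟨b, hb, hb1, hb2⟩ := exists_of_luxemburg_lt (ENNReal.lt_add_right hg1.ne hε2)
  have hab : 0 < a + b := add_pos ha hb
  have key : modular Φ m (fun x => f x + g x) (a + b) ≤ 1 := by
    have h1 : ∀ x, (Φ (‖f x + g x‖₊ / (a + b)) : ℝ≥0∞) ≤
        ((a / (a + b) : ℝ≥0) : ℝ≥0∞) * (Φ (‖f x‖₊ / a) : ℝ≥0∞) +
          ((b / (a + b) : ℝ≥0) : ℝ≥0∞) * (Φ (‖g x‖₊ / b) : ℝ≥0∞) := by
      intro x
      norm_cast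
      have hc := Φ.convex'.2 (mem_univ (‖f x‖₊ / a)) (mem_univ (‖g x‖₊ / b))
        (zero_le : 0 ≤ a / (a + b)) (zero_le : 0 ≤ b / (a + b))
        (by rw [← add_div, div_self hab.ne'])
      refine le_trans (Φ.mono ?_) hc
      simp only [smul_eq_mul]
      rw [div_mul_div_comm, div_mul_div_comm, mul_comm a, mul_comm b, mul_div_mul_right _ _ ha.ne',
        mul_div_mul_right _ _ hb.ne', ← add_div]
      gcongr
      exact nnnorm_add_le _ _
    calc modular Φ m (fun x => f x + g x) (a + b)
        ≤ ∫⁻ x, (((a / (a + b) : ℝ≥0) : ℝ≥0∞) * (Φ (‖f x‖₊ / a) : ℝ≥0∞) +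
          ((b / (a + b) : ℝ≥0) : ℝ≥0∞) * (Φ (‖g x‖₊ / b) : ℝ≥0∞)) ∂m := lintegral_mono h1
      _ = ((a / (a + b) : ℝ≥0) : ℝ≥0∞) * modular Φ m f a +
          ((b / (a + b) : ℝ≥0) : ℝ≥0∞) * modular Φ m g b := by
        rw [lintegral_add_left', lintegral_const_mul' _ _ ENNReal.coe_ne_top,
          lintegral_const_mul' _ _ ENNReal.coe_ne_top]
        · rfl
        · exact ((Φ.measurable.comp_aemeasurable
            (hf.nnnorm.div_const a)).coe_nnreal_ennreal).const_mul _
      _ ≤ ((a / (a + b) : ℝ≥0) : ℝ≥0∞) * 1 + ((b / (a + b) : ℝ≥0) : ℝ≥0∞) * 1 := by gcongr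
      _ = 1 := by
        rw [mul_one, mul_one, ← ENNReal.coe_add, ← add_div, div_self hab.ne', ENNReal.coe_one]
  calc luxemburg Φ m (fun x => f x + g x) ≤ ((a + b : ℝ≥0) : ℝ≥0∞) := luxemburg_le hab key
    _ = a + b := by simp
    _ ≤ (luxemburg Φ m f + (ε / 2 : ℝ≥0)) + (luxemburg Φ m g + (ε / 2 : ℝ≥0)) := by gcongr
    _ = luxemburg Φ m f + luxemburg Φ m g + ε := by
      rw [add_add_add_comm, ← ENNReal.coe_add, add_halves]

theorem ae_eq_zero_of_luxemburg {f : α → ℂ} (hf : AEMeasurable f m) (h : luxemburg Φ m f = 0) :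
    f =ᵐ[m] 0 := by
  have hsmall : ∀ k : ℝ≥0, 0 < k → modular Φ m f k ≤ 1 := by
    intro k hk
    obtain ⟨j, hj, hj1, hj2⟩ := exists_of_luxemburg_lt (Φ := Φ) (m := m) (f := f)
      (a := (k : ℝ≥0∞)) (by rw [h]; exact_mod_cast hk)
    refine le_trans (lintegral_mono fun x => ?_) hj1
    have : j ≤ k := by exact_mod_cast hj2.le
    exact ENNReal.coe_le_coe.2 (Φ.mono (by gcongr))
  have hsets : ∀ n : ℕ, m {x | (1 / (n + 1 : ℝ≥0)) ≤ ‖f x‖₊} = 0 := by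
    intro n
    set ε : ℝ≥0 := 1 / (n + 1 : ℝ≥0) with hε
    have hεpos : 0 < ε := by positivity
    by_contra hne
    set A := {x | ε ≤ ‖f x‖₊}
    have hb : ∀ M : ℝ≥0, (M : ℝ≥0∞) * m A ≤ 1 := by
      intro M
      obtain ⟨y, hy, hy0⟩ := ((Φ.tendsto'.eventually_ge_atTop M).and
        (eventually_gt_atTop 0)).exists
      have hk : 0 < ε / y := div_pos hεpos hy0
      refine le_trans ?_ (hsmall _ hk)
      refine le_trans ?_ (mul_meas_ge_le_lintegral₀ (μ := m)
        (f := fun x => (Φ (‖f x‖₊ / (ε / y)) : ℝ≥0∞))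
        ((Φ.measurable.comp_aemeasurable (hf.nnnorm.div_const _)).coe_nnreal_ennreal) M)
      gcongr
      intro x hx
      change (M : ℝ≥0∞) ≤ _
      norm_cast
      refine hy.trans (Φ.mono ?_)
      rw [le_div_iff₀ hk, mul_div_cancel₀ _ hy0.ne']
      exact hx
    rcases eq_or_ne (m A) ∞ with htop | htop
    · have := hb 1
      simp [htop] at this
    · have h2 := hb (2 * (m A).toNNReal⁻¹)
      have h3 : (m A) = ((m A).toNNReal : ℝ≥0∞) := (ENNReal.coe_toNNReal htop).symm
      have h4 : (m A).toNNReal ≠ 0 := by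
        intro h0; rw [h0] at h3; exact hne (by simpa using h3)
      rw [h3, ← ENNReal.coe_mul] at h2
      simp only [ENNReal.toNNReal_coe] at h2
      rw [mul_assoc, inv_mul_cancel₀ h4] at h2
      norm_num at h2
  have hU : m (⋃ n : ℕ, {x | (1 / (n + 1 : ℝ≥0)) ≤ ‖f x‖₊}) = 0 := measure_iUnion_null hsets
  refine measure_mono_null (fun x hx => ?_) hU
  have hx' : f x ≠ 0 := hx
  obtain ⟨n, hn⟩ := exists_nat_one_div_lt (K := ℝ) (norm_pos_iff.2 hx')
  refine mem_iUnion.2 ⟨n, ?_⟩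
  change (1 / (n + 1 : ℝ≥0)) ≤ ‖f x‖₊
  rw [← NNReal.coe_le_coe]
  push_cast
  exact hn.le

/-- The Orlicz space `L^Φ(m)`, as a subspace of the space of classes of measurable functions
modulo equality almost everywhere. -/
def orliczSubmodule (Φ : YoungFunction) (m : Measure α) : Submodule ℂ (α →ₘ[m] ℂ) where
  carrier := {f | luxemburg Φ m f < ∞}
  zero_mem' := by
    have : luxemburg Φ m ((0 : α →ₘ[m] ℂ) : α → ℂ) = 0 :=
      (luxemburg_congr AEEqFun.coeFn_zero).trans luxemburg_zero
    simp [this]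
  add_mem' := by
    intro f g hf hg
    have h := (luxemburg_congr (Φ := Φ) (AEEqFun.coeFn_add f g)).trans_le
      (luxemburg_add_le f.aemeasurable)
    exact h.trans_lt (ENNReal.add_lt_top.2 ⟨hf, hg⟩)
  smul_mem' := by
    intro c f hf
    have h := (luxemburg_congr (Φ := Φ) (AEEqFun.coeFn_smul c f)).trans_le
      (luxemburg_const_mul_le c f)
    exact h.trans_lt (ENNReal.mul_lt_top ENNReal.coe_lt_top hf)

/-- The Orlicz space `L^Φ(m)` of classes of complex measurable functions. -/
def Orlicz (Φ : YoungFunction) (m : Measure α) : Type _ := ↥(orliczSubmodule Φ m)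

noncomputable instance : AddCommGroup (Orlicz Φ m) :=
  inferInstanceAs (AddCommGroup ↥(orliczSubmodule Φ m))

noncomputable instance : Module ℂ (Orlicz Φ m) :=
  inferInstanceAs (Module ℂ ↥(orliczSubmodule Φ m))

/-- A representative of an element of the Orlicz space. -/
noncomputable instance : CoeFun (Orlicz Φ m) (fun _ => α → ℂ) := ⟨fun f => (f.1 : α → ℂ)⟩

theorem Orlicz.coeFn_add (f g : Orlicz Φ m) : (f + g) =ᵐ[m] fun x => f x + g x :=
  AEEqFun.coeFn_add f.1 g.1

theorem Orlicz.coeFn_smul (c : ℂ) (f : Orlicz Φ m) : (c • f) =ᵐ[m] fun x => c * f x :=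
  AEEqFun.coeFn_smul c f.1

theorem Orlicz.aemeasurable (f : Orlicz Φ m) : AEMeasurable f m := f.1.aemeasurable

/-- `L^Φ(m)` with the Luxemburg norm. -/
noncomputable instance : NormedAddCommGroup (Orlicz Φ m) :=
  AddGroupNorm.toNormedAddCommGroup
    { toFun := fun f => (luxemburg Φ m f).toReal
      map_zero' := by
        have : luxemburg Φ m ((0 : Orlicz Φ m) : α → ℂ) = 0 :=
          (luxemburg_congr AEEqFun.coeFn_zero).trans luxemburg_zero
        simp [this]
      add_le' := fun f g => by
        have h := (luxemburg_congr (Φ := Φ) (Orlicz.coeFn_add f g)).trans_le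
          (luxemburg_add_le f.aemeasurable)
        have h1 : luxemburg Φ m f < ∞ := f.2
        have h2 : luxemburg Φ m g < ∞ := g.2
        exact ENNReal.toReal_le_add h h1.ne h2.ne
      neg' := fun f => by
        have h0 : (-f) = (-1 : ℂ) • f := by simp
        have h := (luxemburg_congr (Φ := Φ) (Orlicz.coeFn_smul (-1) f)).trans
          (luxemburg_const_mul (-1) f)
        rw [h0, h]; simp
      eq_zero_of_map_eq_zero' := fun f h => by
        have h1 : luxemburg Φ m f < ∞ := f.2
        have h2 : luxemburg Φ m f = 0 := ((ENNReal.toReal_eq_zero_iff _).1 h).resolve_right h1.ne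
        refine Subtype.ext (AEEqFun.ext ?_)
        exact (ae_eq_zero_of_luxemburg f.aemeasurable h2).trans AEEqFun.coeFn_zero.symm }

theorem Orlicz.norm_def (f : Orlicz Φ m) : ‖f‖ = (luxemburg Φ m f).toReal := rfl

noncomputable instance : NormedSpace ℂ (Orlicz Φ m) where
  norm_smul_le c f := by
    have h := (luxemburg_congr (Φ := Φ) (Orlicz.coeFn_smul c f)).trans (luxemburg_const_mul c f)
    rw [Orlicz.norm_def, Orlicz.norm_def, h]; simp

theorem luxemburg_indicator_lt_top [IsFiniteMeasure m] (A : Set α) :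
    luxemburg Φ m (A.indicator fun _ => 1) < ∞ := by
  set M : ℝ≥0 := Φ 1 * (m univ).toNNReal
  have hk : 0 < M + 1 := by positivity
  refine (luxemburg_le hk ?_).trans_lt ENNReal.coe_lt_top
  have h1 : ∀ x, (Φ (‖A.indicator (fun _ => (1 : ℂ)) x‖₊ / (M + 1)) : ℝ≥0∞) ≤
      (((M + 1)⁻¹ * Φ 1 : ℝ≥0) : ℝ≥0∞) := by
    intro x
    norm_cast
    refine le_trans (Φ.mono ?_) (Φ.map_mul_le (inv_le_one_of_one_le₀ (by simp)) 1)
    rw [div_eq_mul_inv, mul_comm]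
    gcongr
    by_cases hx : x ∈ A <;> simp [hx]
  refine (lintegral_mono h1).trans ?_
  rw [lintegral_const, ← ENNReal.coe_toNNReal (measure_ne_top m univ)]
  norm_cast
  rw [mul_assoc, inv_mul_eq_div]
  exact div_le_one_of_le₀ (by simp [M]) zero_le

/-- The class of the characteristic function `χ_A` in `L^Φ(m)`. -/
noncomputable def Orlicz.chi (Φ : YoungFunction) (m : Measure α) [IsFiniteMeasure m] (A : Set α)
    (hA : MeasurableSet A) : Orlicz Φ m :=
  ⟨AEEqFun.mk (A.indicator fun _ => 1)
      ((measurable_const.indicator hA).aestronglyMeasurable), by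
    change luxemburg Φ m _ < ∞
    rw [luxemburg_congr (AEEqFun.coeFn_mk _ _)]
    exact luxemburg_indicator_lt_top A⟩

end Orlicz

/-! ### Integration with respect to a vector measure -/

section VectorMeasure

variable {Ω : Type*} [MeasurableSpace Ω] {X : Type*} [NormedAddCommGroup X] [NormedSpace ℂ X]

/-- The scalar measure `⟨ν, x'⟩`. -/
noncomputable def scalarMeasure (ν : VectorMeasure Ω X) (ℓ : StrongDual ℂ X) : ComplexMeasure Ω :=
  ν.mapRange (ℓ : X →+ ℂ) ℓ.continuous

/-- `‖f‖_ν = sup_{‖x'‖ ≤ 1} ∫ |f| d|⟨ν, x'⟩|`, as an element of `[0,∞]`. -/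
noncomputable def vNorm (ν : VectorMeasure Ω X) (f : Ω → ℂ) : ℝ≥0∞ :=
  ⨆ (ℓ : StrongDual ℂ X) (_ : ‖ℓ‖ ≤ 1), ∫⁻ x, ‖f x‖ₑ ∂(scalarMeasure ν ℓ).variation

/-- `ν`-weak integrability of a measurable function. -/
def IsWeaklyIntegrable (ν : VectorMeasure Ω X) (f : Ω → ℂ) : Prop :=
  Measurable f ∧ ∀ ℓ : StrongDual ℂ X, (scalarMeasure ν ℓ).Integrable f

/-- `ν`-integrability: `f` is weakly integrable and each `A` measurable admits a vector
`x_A = ∫_A f dν` with `∫_A f d⟨ν, x'⟩ = ⟨x_A, x'⟩` for all `x'` (by Hahn--Banach, `x_A` is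
unique). -/
def IsVIntegrable (ν : VectorMeasure Ω X) (f : Ω → ℂ) : Prop :=
  IsWeaklyIntegrable ν f ∧ ∀ A, MeasurableSet A → ∃ xA : X, ∀ ℓ : StrongDual ℂ X,
    ((scalarMeasure ν ℓ).restrict A).integral f (ContinuousLinearMap.mul ℝ ℂ) = ℓ xA

variable {ν : VectorMeasure Ω X}

theorem scalarMeasure_apply (ℓ : StrongDual ℂ X) (A : Set Ω) : scalarMeasure ν ℓ A = ℓ (ν A) := rfl

theorem scalarMeasure_add (ℓ₁ ℓ₂ : StrongDual ℂ X) :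
    scalarMeasure ν (ℓ₁ + ℓ₂) = scalarMeasure ν ℓ₁ + scalarMeasure ν ℓ₂ := by
  ext A hA; simp [scalarMeasure_apply]

theorem scalarMeasure_smul (c : ℂ) (ℓ : StrongDual ℂ X) :
    scalarMeasure ν (c • ℓ) = c • scalarMeasure ν ℓ := by
  ext A hA; simp [scalarMeasure_apply]

theorem lowerSemicontinuous_variation {A : Set Ω} (hA : MeasurableSet A) :
    LowerSemicontinuous fun ℓ : StrongDual ℂ X => (scalarMeasure ν ℓ).variation A := by
  intro ℓ a ha
  obtain ⟨P, h1, h2, -, h4⟩ := VectorMeasure.exists_lt_sum_of_lt_variation _ hA ha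
  have hc : Continuous fun ℓ' : StrongDual ℂ X => ∑ p ∈ P, ‖scalarMeasure ν ℓ' p‖ₑ := by
    refine continuous_finsetSum _ fun p _ => Continuous.enorm ?_
    simp only [scalarMeasure_apply]
    exact (ContinuousLinearMap.apply ℂ ℂ (ν p)).continuous
  filter_upwards [hc.continuousAt.eventually_const_lt h4] with ℓ' h
  exact h.trans_le (VectorMeasure.le_variation _ hA h1 h2)

theorem lowerSemicontinuous_lintegral (g : Ω → ℝ≥0∞) :
    LowerSemicontinuous fun ℓ : StrongDual ℂ X => ∫⁻ x, g x ∂(scalarMeasure ν ℓ).variation := by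
  simp only [lintegral_eq_nnreal]
  refine lowerSemicontinuous_iSup fun φ => lowerSemicontinuous_iSup fun _ => ?_
  simp only [SimpleFunc.lintegral]
  refine lowerSemicontinuous_sum fun c hc => ?_
  have hct : c ≠ ∞ := by
    obtain ⟨x, rfl⟩ := SimpleFunc.mem_range.1 hc
    simp
  exact (ENNReal.continuous_const_mul hct).comp_lowerSemicontinuous
    (lowerSemicontinuous_variation (SimpleFunc.measurableSet_fiber _ _))
    fun _ _ h => mul_le_mul_right h c

/-- The norm `‖f‖_ν` is finite for weakly integrable `f`, by the uniform boundedness principle. -/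
theorem vNorm_lt_top {f : Ω → ℂ} (hf : IsWeaklyIntegrable ν f) : vNorm ν f < ∞ := by
  set p : StrongDual ℂ X → ℝ≥0∞ := fun ℓ => ∫⁻ x, ‖f x‖ₑ ∂(scalarMeasure ν ℓ).variation with hp
  have hfin : ∀ ℓ, p ℓ ≠ ∞ := fun ℓ => (hf.2 ℓ).2.ne
  let q : Seminorm ℂ (StrongDual ℂ X) := Seminorm.of (fun ℓ => (p ℓ).toReal)
    (fun ℓ₁ ℓ₂ => by
      refine ENNReal.toReal_le_add ?_ (hfin _) (hfin _)
      simp only [hp, scalarMeasure_add]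
      rw [← lintegral_add_measure]
      exact lintegral_mono' VectorMeasure.variation_add_le le_rfl)
    (fun c ℓ => by
      simp only [hp, scalarMeasure_smul, VectorMeasure.variation_smul, lintegral_smul_measure]
      simp [ENNReal.smul_def])
  have hq : LowerSemicontinuous q := by
    intro ℓ y hy
    change y < (p ℓ).toReal at hy
    rcases lt_or_ge y 0 with hy0 | hy0
    · exact Eventually.of_forall fun ℓ' => hy0.trans_le ENNReal.toReal_nonneg
    · have h := lowerSemicontinuous_lintegral (ν := ν) (fun x => ‖f x‖ₑ) ℓ (ENNReal.ofReal y)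
        ((ENNReal.ofReal_lt_iff_lt_toReal hy0 (hfin ℓ)).2 hy)
      filter_upwards [h] with ℓ' h'
      exact (ENNReal.ofReal_lt_iff_lt_toReal hy0 (hfin ℓ')).1 h'
  obtain ⟨C, hC, hb⟩ := Seminorm.bound_of_continuous_normedSpace q
    (q.continuous_of_lowerSemicontinuous hq)
  refine lt_of_le_of_lt (iSup₂_le fun ℓ hℓ => ?_) (ENNReal.ofReal_lt_top (r := C))
  change p ℓ ≤ _
  rw [← ENNReal.ofReal_toReal (hfin ℓ)]
  refine ENNReal.ofReal_le_ofReal ((hb ℓ).trans ?_)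
  exact mul_le_of_le_one_right hC.le hℓ

theorem integral_const_mul (lam : ComplexMeasure Ω) (c : ℂ) (f : Ω → ℂ) :
    lam.integral (c • f) (ContinuousLinearMap.mul ℝ ℂ) =
      c * lam.integral f (ContinuousLinearMap.mul ℝ ℂ) := by
  rw [VectorMeasure.integral_eq_setToFun, VectorMeasure.integral_eq_setToFun, ← smul_eq_mul]
  refine setToFun_smul _ (fun c s x => ?_) c f
  simp [VectorMeasure.transpose]
  ring

theorem vNorm_zero : vNorm ν (fun _ => 0) = 0 := by simp [vNorm]

theorem vNorm_const_mul (c : ℂ) (f : Ω → ℂ) :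
    vNorm ν (fun x => c * f x) = ‖c‖ₑ * vNorm ν f := by
  simp only [vNorm, enorm_mul, lintegral_const_mul' _ _ enorm_ne_top, ENNReal.mul_iSup]

theorem vNorm_add_le {f g : Ω → ℂ} (hf : Measurable f) :
    vNorm ν (fun x => f x + g x) ≤ vNorm ν f + vNorm ν g := by
  refine iSup₂_le fun ℓ hℓ => ?_
  calc ∫⁻ x, ‖f x + g x‖ₑ ∂(scalarMeasure ν ℓ).variation
      ≤ ∫⁻ x, (‖f x‖ₑ + ‖g x‖ₑ) ∂(scalarMeasure ν ℓ).variation :=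
        lintegral_mono fun x => enorm_add_le _ _
    _ = _ := lintegral_add_left hf.enorm _
    _ ≤ _ := by
      refine add_le_add ?_ ?_
      · exact le_iSup₂_of_le (f := fun (ℓ : StrongDual ℂ X) (_ : ‖ℓ‖ ≤ 1) =>
          ∫⁻ x, ‖f x‖ₑ ∂(scalarMeasure ν ℓ).variation) ℓ hℓ le_rfl
      · exact le_iSup₂_of_le (f := fun (ℓ : StrongDual ℂ X) (_ : ‖ℓ‖ ≤ 1) =>
          ∫⁻ x, ‖g x‖ₑ ∂(scalarMeasure ν ℓ).variation) ℓ hℓ le_rfl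

/-- The vector space of `ν`-integrable functions. -/
def integrableSubmodule (ν : VectorMeasure Ω X) : Submodule ℂ (Ω → ℂ) where
  carrier := {f | IsVIntegrable ν f}
  zero_mem' := by
    refine ⟨⟨measurable_const, fun ℓ => integrable_zero _ _ _⟩, fun A hA => ⟨0, fun ℓ => ?_⟩⟩
    rw [map_zero]
    exact VectorMeasure.integral_zero
  add_mem' := by
    rintro f g ⟨⟨hf1, hf2⟩, hf3⟩ ⟨⟨hg1, hg2⟩, hg3⟩
    refine ⟨⟨hf1.add hg1, fun ℓ => (hf2 ℓ).add (hg2 ℓ)⟩, fun A hA => ?_⟩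
    obtain ⟨x, hx⟩ := hf3 A hA
    obtain ⟨y, hy⟩ := hg3 A hA
    refine ⟨x + y, fun ℓ => ?_⟩
    rw [map_add, ← hx, ← hy]
    exact VectorMeasure.integral_add (hf2 ℓ).restrict (hg2 ℓ).restrict
  smul_mem' := by
    rintro c f ⟨⟨hf1, hf2⟩, hf3⟩
    refine ⟨⟨hf1.const_smul c, fun ℓ => MeasureTheory.Integrable.smul c (hf2 ℓ)⟩,
      fun A hA => ?_⟩
    obtain ⟨x, hx⟩ := hf3 A hA
    refine ⟨c • x, fun ℓ => ?_⟩
    rw [map_smul, ← hx, smul_eq_mul]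
    exact integral_const_mul _ _ _

/-- The space of `ν`-integrable functions, before identifying functions that are equal
`ν`-almost everywhere. -/
def PreL1 (ν : VectorMeasure Ω X) : Type _ := ↥(integrableSubmodule ν)

noncomputable instance : AddCommGroup (PreL1 ν) :=
  inferInstanceAs (AddCommGroup ↥(integrableSubmodule ν))

noncomputable instance : Module ℂ (PreL1 ν) :=
  inferInstanceAs (Module ℂ ↥(integrableSubmodule ν))

noncomputable instance : SeminormedAddCommGroup (PreL1 ν) :=
  AddGroupSeminorm.toSeminormedAddCommGroup
    { toFun := fun f => (vNorm ν f.1).toReal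
      map_zero' := by
        have : vNorm ν (0 : PreL1 ν).1 = 0 := vNorm_zero
        simp [this]
      add_le' := fun f g =>
        ENNReal.toReal_le_add (vNorm_add_le f.2.1.1) (vNorm_lt_top f.2.1).ne (vNorm_lt_top g.2.1).ne
      neg' := fun f => by
        have h0 : (-f) = (-1 : ℂ) • f := by simp
        have h : vNorm ν ((-1 : ℂ) • f).1 = _ := vNorm_const_mul (-1) f.1
        rw [h0, h]; simp }

theorem PreL1.norm_def (f : PreL1 ν) : ‖f‖ = (vNorm ν f.1).toReal := rfl

noncomputable instance : NormedSpace ℂ (PreL1 ν) where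
  norm_smul_le c f := by
    have h : vNorm ν (c • f).1 = _ := vNorm_const_mul c f.1
    rw [PreL1.norm_def, PreL1.norm_def, h]; simp

/-- The normed space `L¹(ν)`: the `ν`-integrable functions with the norm `‖·‖_ν`, where `f` and
`g` are identified if `‖f - g‖_ν = 0`, that is, if they differ on a `ν`-null set only. -/
abbrev VL1 (ν : VectorMeasure Ω X) : Type _ := SeparationQuotient (PreL1 ν)

/-- The class in `L¹(ν)` of a `ν`-integrable function. -/
noncomputable def VL1.mk (f : Ω → ℂ) (hf : IsVIntegrable ν f) : VL1 ν :=
  SeparationQuotient.mk (⟨f, hf⟩ : PreL1 ν)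

end VectorMeasure

/-! ### The convolution operator and its vector measure -/

section Convolution

variable {G : Type*} [Group G] [MeasurableSpace G]

/-- `(μ * f)(t) = ∫ f(s⁻¹ t) dμ(s)`. -/
noncomputable def conv (μ : ComplexMeasure G) (f : G → ℂ) (t : G) : ℂ :=
  μ.integral (fun s => f (s⁻¹ * t)) (ContinuousLinearMap.mul ℝ ℂ)

variable {Φ : YoungFunction} {m : Measure G}

/-- `T` is the convolution operator `f ↦ μ * f` on `L^Φ(G)`: for every `f`, the integral that
defines `μ * f` converges absolutely almost everywhere, and `T f = μ * f` almost everywhere. These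
properties determine `T`. -/
def IsConvolutionOperator (μ : ComplexMeasure G) (T : Orlicz Φ m →L[ℂ] Orlicz Φ m) : Prop :=
  ∀ f : Orlicz Φ m, (∀ᵐ t ∂m, μ.Integrable fun s => f (s⁻¹ * t)) ∧ T f =ᵐ[m] conv μ f

/-- `ν` is the vector measure `A ↦ T χ_A` associated with `T`. -/
def IsAssociatedMeasure [IsFiniteMeasure m] (T : Orlicz Φ m →L[ℂ] Orlicz Φ m)
    (ν : VectorMeasure G (Orlicz Φ m)) : Prop :=
  ∀ A (hA : MeasurableSet A), ν A = T (Orlicz.chi Φ m A hA)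

/-- `ι` is the inclusion of `L^Φ(G)` into `L¹(ν)`: the class of `f` modulo `m`-null functions is
sent to the class of `f` modulo `ν`-null functions, for each measurable representative, and no two
classes are identified. -/
def IsInclusion (ν : VectorMeasure G (Orlicz Φ m)) (ι : Orlicz Φ m →L[ℂ] VL1 ν) : Prop :=
  (∀ (f : Orlicz Φ m) (g : G → ℂ), Measurable g → g =ᵐ[m] f →
    ∃ hg : IsVIntegrable ν g, ι f = VL1.mk g hg) ∧ Function.Injective ι

end Convolution

end OrliczConv

/-! The upper bounds rest on `‖T‖ ≤ ‖μ‖` for `T f = μ * f`. Pointwise, `|μ * f|(t)` is at most `‖μ‖`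
times the average of `s ↦ |f(s⁻¹t)|` for the normalized `|μ|`. Jensen's inequality, Tonelli's
theorem and left invariance of `m` bound the modular of `μ * f` at scale `‖μ‖ k` by that of `f` at
scale `k` (`modular_conv_le`). Since `G` need not be second countable, `(t, s) ↦ s⁻¹t` need not be
measurable for the product of the Borel `σ`-algebras. Tonelli's theorem is therefore proved through
the Baire `σ`-algebra, from which Borel sets differ only by `m`-null sets (`lintegral_inv_mul`).

The rest of the upper bound holds for any bounded `T : L^Φ → X` and `ν(A) = T χ_A`. The
`Δ₂`-condition gives dominated convergence in `L^Φ`, hence `σ`-additivity of `ν` and `∫ f d⟨ν, ℓ⟩ =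
ℓ (T f)` for integrable `f` in `L^Φ`. Writing `d⟨ν, ℓ⟩ = h d|⟨ν, ℓ⟩|` with `|h| = 1` and testing
with `|f| h̄` yields `∫ |f| d|⟨ν, ℓ⟩| ≤ ‖ℓ‖ ‖T‖ ‖f‖` (`lintegral_le`). This gives integrability, (i)
and `‖ι‖ ≤ ‖T‖ ≤ ‖μ‖`.

For injectivity, `‖f‖_ν = 0` makes `E = {f ≠ 0}` null for every `|⟨ν, ℓ⟩|`, so `μ * χ_E = ν(E) = 0`
by Hahn–Banach; integrating over `G` gives `μ(G) m(E) = 0`. For the lower bound, `μ * 1 = μ(G)`, so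
`|μ(G)| ‖1‖ = ‖ν(G)‖ ≤ ‖1‖_ν ≤ ‖ι‖ ‖1‖`. -/

namespace OrliczConv

/-! ### Complex measures: finiteness of the variation, polar decomposition, integrals. -/

section ComplexMeasure

variable {Ω : Type*} [MeasurableSpace Ω]

theorem isFiniteMeasure_variation (μ : ComplexMeasure Ω) : IsFiniteMeasure μ.variation := by
  have h : μ.variation ≤ (ComplexMeasure.re μ).totalVariation +
      (ComplexMeasure.im μ).totalVariation := by
    refine VectorMeasure.variation_le_of_forall_enorm_le fun s _ => ?_
    calc ‖μ s‖ₑ = ‖((μ s).re : ℂ) + (μ s).im * Complex.I‖ₑ := by rw [Complex.re_add_im]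
      _ ≤ ‖(μ s).re‖ₑ + ‖(μ s).im‖ₑ := by
        refine (enorm_add_le _ _).trans_eq ?_
        simp [← ofReal_norm]
      _ ≤ _ := add_le_add (SignedMeasure.enorm_le_totalVariation (ComplexMeasure.re μ) s)
        (SignedMeasure.enorm_le_totalVariation (ComplexMeasure.im μ) s)
  exact isFiniteMeasure_of_le _ h

/-- The polar decomposition of a complex measure. -/
theorem exists_polar (μ : ComplexMeasure Ω) : ∃ h : Ω → ℂ, Measurable h ∧
    Integrable h μ.variation ∧ (∀ x, ‖h x‖ = 1) ∧
    μ.variation.withDensityᵥ h = μ := by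
  have := isFiniteMeasure_variation μ
  set ρ := μ.variation
  have hac : ∀ i, ρ i = 0 → μ i = 0 := fun i hi => by
    have := VectorMeasure.enorm_measure_le_variation μ i
    rw [show μ.variation i = 0 from hi] at this
    simpa using this
  have hre : ρ.withDensityᵥ ((ComplexMeasure.re μ).rnDeriv ρ) = ComplexMeasure.re μ := by
    refine (SignedMeasure.absolutelyContinuous_iff_withDensityᵥ_rnDeriv_eq _ _).1
      (VectorMeasure.AbsolutelyContinuous.mk fun i hi h0 => ?_)
    rw [Measure.toENNRealVectorMeasure_apply_measurable hi] at h0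
    change (μ i).re = 0
    simp [hac i h0]
  have him : ρ.withDensityᵥ ((ComplexMeasure.im μ).rnDeriv ρ) = ComplexMeasure.im μ := by
    refine (SignedMeasure.absolutelyContinuous_iff_withDensityᵥ_rnDeriv_eq _ _).1
      (VectorMeasure.AbsolutelyContinuous.mk fun i hi h0 => ?_)
    rw [Measure.toENNRealVectorMeasure_apply_measurable hi] at h0
    change (μ i).im = 0
    simp [hac i h0]
  have hint := ComplexMeasure.integrable_rnDeriv μ ρ
  have hμ : ρ.withDensityᵥ (μ.rnDeriv ρ) = μ := by
    ext i hi
    rw [withDensityᵥ_apply hint hi]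
    refine Complex.ext ?_ ?_
    · rw [← RCLike.re_eq_complex_re, ← integral_re hint.integrableOn]
      have h2 := congrArg (fun v : SignedMeasure Ω => v i) hre
      rw [withDensityᵥ_apply (SignedMeasure.integrable_rnDeriv _ _) hi] at h2
      exact h2
    · rw [← RCLike.im_eq_complex_im, ← integral_im hint.integrableOn]
      have h2 := congrArg (fun v : SignedMeasure Ω => v i) him
      rw [withDensityᵥ_apply (SignedMeasure.integrable_rnDeriv _ _) hi] at h2
      exact h2
  have hmeas : Measurable (μ.rnDeriv ρ) := by
    have h1 : Measurable ((ComplexMeasure.re μ).rnDeriv ρ) := SignedMeasure.measurable_rnDeriv _ _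
    have h2 : Measurable ((ComplexMeasure.im μ).rnDeriv ρ) := SignedMeasure.measurable_rnDeriv _ _
    exact Complex.measurableEquivRealProd.symm.measurable.comp (h1.prodMk h2)
  -- The variation of `d ρ`, for a density `d`, is `|d| ρ`. Here it is `ρ` itself, so `|d| = 1`
  -- almost everywhere.
  have h1 := Measure.variation_withDensityᵥ hint
  rw [hμ] at h1
  have h2 : ρ.withDensity (fun x => ‖μ.rnDeriv ρ x‖ₑ) = ρ.withDensity 1 := by
    rw [withDensity_one]; exact h1.symm
  have h3 := (withDensity_eq_iff hmeas.enorm.aemeasurable measurable_one.aemeasurable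
    hint.2.ne).1 h2
  have hA : MeasurableSet {x | ‖μ.rnDeriv ρ x‖ = 1} :=
    hmeas.norm (measurableSet_singleton 1)
  classical
  -- Changing the density to `1` on the exceptional null set gives modulus one everywhere.
  set h := {x | ‖μ.rnDeriv ρ x‖ = 1}.piecewise (μ.rnDeriv ρ) fun _ => 1 with hh
  have hae : μ.rnDeriv ρ =ᵐ[ρ] h := by
    filter_upwards [h3] with x hx
    have h4 : ‖μ.rnDeriv ρ x‖ₑ = 1 := hx
    have h5 : x ∈ {x | ‖μ.rnDeriv ρ x‖ = 1} := by
      rw [mem_ofPred_eq, ← toReal_enorm, h4]; simp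
    rw [hh, piecewise_eq_of_mem _ _ _ h5]
  refine ⟨h, hmeas.piecewise hA measurable_const, hint.congr hae, fun x => ?_,
    (WithDensityᵥEq.congr_ae hae).symm.trans hμ⟩
  by_cases hx : x ∈ {x | ‖μ.rnDeriv ρ x‖ = 1}
  · rw [hh, piecewise_eq_of_mem _ _ _ hx]; exact hx
  · rw [hh, piecewise_eq_of_notMem _ _ _ hx, norm_one]

/-- This turns integrals against `μ` into Bochner integrals, for which Fubini's theorem and
multiplication by `h̄` are available. Both sides are continuous on `L¹(|μ|)` and agree on
indicators. -/
theorem integral_eq_integral_mul {μ : ComplexMeasure Ω} {h : Ω → ℂ}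
    (hi : Integrable h μ.variation) (hn : ∀ x, ‖h x‖ = 1)
    (hμ : μ.variation.withDensityᵥ h = μ) {f : Ω → ℂ} (hf : μ.Integrable f) :
    μ.integral f (ContinuousLinearMap.mul ℝ ℂ) = ∫ x, f x * h x ∂μ.variation := by
  have := isFiniteMeasure_variation μ
  have hmul : ∀ {g : Ω → ℂ}, Integrable g μ.variation →
      Integrable (fun x => g x * h x) μ.variation := fun hg =>
    hg.mul_bdd (c := 1) hi.1 (Eventually.of_forall fun x => (hn x).le)
  refine Integrable.induction (μ := μ.variation)
    (fun f => μ.integral f (ContinuousLinearMap.mul ℝ ℂ) = ∫ x, f x * h x ∂μ.variation)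
    ?_ ?_ ?_ ?_ hf
  · intro c s hs _
    rw [VectorMeasure.integral_indicator_const c hs]
    have h1 : (fun x => s.indicator (fun _ => c) x * h x) = s.indicator fun x => c * h x := by
      ext x; by_cases hx : x ∈ s <;> simp [hx]
    have h2 : μ s = ∫ x in s, h x ∂μ.variation := by
      rw [← withDensityᵥ_apply hi hs, hμ]
    rw [h1, integral_indicator hs, MeasureTheory.integral_const_mul, ← h2]; rfl
  · intro f g _ hf hg h1 h2
    rw [show (f + g) = fun x => f x + g x from rfl, VectorMeasure.integral_fun_add hf hg, h1, h2,
      ← MeasureTheory.integral_add (hmul hf) (hmul hg)]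
    simp only [add_mul]
  -- Since `|h| = 1`, multiplication by `h` preserves `L¹` distances.
  · refine isClosed_eq VectorMeasure.continuous_integral ?_
    refine continuous_iff_continuousAt.2 fun f => ?_
    refine tendsto_integral_of_L1 _ (hmul (L1.integrable_coeFn f)).1
      (Eventually.of_forall fun g => hmul (L1.integrable_coeFn g)) ?_
    have h0 : Tendsto (fun g : Ω →₁[μ.variation] ℂ => edist g f) (𝓝 f) (𝓝 0) := by
      have : Continuous fun g : Ω →₁[μ.variation] ℂ => edist g f := by fun_prop
      simpa using this.tendsto f
    refine h0.congr fun g => ?_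
    rw [L1.edist_def]
    refine lintegral_congr fun x => ?_
    rw [← sub_mul, enorm_mul, ← ofReal_norm (h x), hn, edist_eq_enorm_sub]; simp
  · intro f g hfg _ h1
    rw [← VectorMeasure.integral_congr_ae hfg, h1]
    exact integral_congr_ae (hfg.mono fun x hx => by simp only [hx])

end ComplexMeasure

/-! ### Young functions -/

namespace YoungFunction

variable (Φ : YoungFunction)

/-- The extension of `Φ` to the real line by `0` on the negative half-line. -/
noncomputable def realExt (x : ℝ) : ℝ := Φ x.toNNReal

/-- Monotonicity of `Φ` keeps the extension by `0` convex across the origin. Convexity on the open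
set `ℝ` then gives continuity of `Φ` even at the endpoint `0`. -/
theorem realExt_convexOn : ConvexOn ℝ univ Φ.realExt := by
  refine ⟨convex_univ, fun x _ y _ a b ha hb hab => ?_⟩
  have h := Φ.convex'.2 (mem_univ x.toNNReal) (mem_univ y.toNNReal)
    (zero_le : 0 ≤ a.toNNReal) (zero_le : 0 ≤ b.toNNReal)
    (by rw [← Real.toNNReal_add ha hb, hab, Real.toNNReal_one])
  have h2 : (a • x + b • y).toNNReal ≤ a.toNNReal • x.toNNReal + b.toNNReal • y.toNNReal := by
    refine Real.toNNReal_add_le.trans ?_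
    simp only [smul_eq_mul, Real.toNNReal_mul ha, Real.toNNReal_mul hb, le_refl]
  have h3 := NNReal.coe_le_coe.2 ((Φ.mono h2).trans h)
  simp only [smul_eq_mul, NNReal.coe_add, NNReal.coe_mul, Real.coe_toNNReal _ ha,
    Real.coe_toNNReal _ hb] at h3
  exact h3

theorem realExt_continuous : Continuous Φ.realExt :=
  continuousOn_univ.1 (Φ.realExt_convexOn.continuousOn isOpen_univ)

theorem continuous : Continuous Φ := by
  have h : (Φ : ℝ≥0 → ℝ≥0) = fun x : ℝ≥0 => (Φ.realExt x).toNNReal := by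
    ext x; simp [realExt]
  rw [h]
  exact continuous_real_toNNReal.comp (Φ.realExt_continuous.comp NNReal.continuous_coe)

/-- A Young function grows at least linearly. -/
theorem exists_le_add_mul : ∃ y : ℝ≥0, ∀ x, x ≤ y + y * Φ x := by
  obtain ⟨y, hy1, hy⟩ := ((Φ.tendsto'.eventually_ge_atTop 1).and (eventually_gt_atTop 0)).exists
  refine ⟨y, fun x => ?_⟩
  rcases le_total x y with h | h
  · exact h.trans (by simp)
  have hx : 0 < x := hy.trans_le h
  -- As `Φ 0 = 0`, convexity gives `1 ≤ Φ y ≤ (y / x) Φ x` for `x ≥ y`.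
  have h1 := Φ.map_mul_le (div_le_one_of_le₀ h zero_le) x
  rw [div_mul_cancel₀ _ hx.ne'] at h1
  have h2 : 1 ≤ y * Φ x / x := by
    rw [mul_div_right_comm]; exact hy1.trans h1
  rw [le_div_iff₀ hx, one_mul] at h2
  exact h2.trans (by simp)

/-- Jensen's inequality for a Young function and a finite measure. -/
theorem mul_measure_le_lintegral {Ω : Type*} [MeasurableSpace Ω] (ρ : Measure Ω)
    [IsFiniteMeasure ρ] {f : Ω → ℂ} (hf : Integrable f ρ) (k : ℝ≥0) :
    (Φ ((∫ x, ‖f x‖ ∂ρ).toNNReal / ((ρ univ).toNNReal * k)) : ℝ≥0∞) * ρ univ ≤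
      ∫⁻ x, (Φ (‖f x‖₊ / k) : ℝ≥0∞) ∂ρ := by
  rcases eq_zero_or_neZero ρ with rfl | hρ
  · simp
  -- Outside this trivial case `Φ(|f| / k)` is integrable, as Jensen's inequality for real functions
  -- requires.
  by_cases htop : ∫⁻ x, (Φ (‖f x‖₊ / k) : ℝ≥0∞) ∂ρ = ∞
  · rw [htop]; exact le_top
  set u : Ω → ℝ := fun x => ‖f x‖ / k with hu
  have hui : Integrable u ρ := hf.norm.div_const _
  have hcomp : ∀ x, Φ.realExt (u x) = ((Φ (‖f x‖₊ / k) : ℝ≥0) : ℝ) := fun x => by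
    rw [realExt, hu, Real.toNNReal_div (norm_nonneg _)]; simp [norm_toNNReal]
  have hmeas : AEMeasurable (fun x => Φ (‖f x‖₊ / k)) ρ :=
    Φ.measurable.comp_aemeasurable (hf.aemeasurable.nnnorm.div_const k)
  have hgi : Integrable (Φ.realExt ∘ u) ρ := by
    refine ⟨Φ.realExt_continuous.comp_aestronglyMeasurable hui.1, ?_⟩
    rw [hasFiniteIntegral_iff_enorm]
    refine lt_of_le_of_lt (lintegral_mono fun x => ?_) (lt_top_iff_ne_top.2 htop)
    rw [Function.comp_apply, hcomp]; simp [enorm_eq_nnnorm]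
  have hj := Φ.realExt_convexOn.map_average_le Φ.realExt_continuous.continuousOn isClosed_univ
    (Eventually.of_forall fun _ => mem_univ _) hui hgi
  have hMpos : 0 < ρ.real univ := by
    rw [measureReal_def]
    exact ENNReal.toReal_pos (NeZero.ne _) (measure_ne_top _ _)
  have hav : (⨍ x, u x ∂ρ).toNNReal = (∫ x, ‖f x‖ ∂ρ).toNNReal / ((ρ univ).toNNReal * k) := by
    rw [average_eq, hu, integral_div, smul_eq_mul, ← div_eq_inv_mul, div_div,
      Real.toNNReal_div (integral_nonneg fun _ => norm_nonneg _), mul_comm,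
      Real.toNNReal_mul measureReal_nonneg, Real.toNNReal_coe, measureReal_def,
      ENNReal.toNNReal_toReal_eq]
  have hint : ∫ x, Φ.realExt (u x) ∂ρ = (∫⁻ x, (Φ (‖f x‖₊ / k) : ℝ≥0∞) ∂ρ).toReal := by
    simp only [hcomp]
    rw [integral_eq_lintegral_of_nonneg_ae (Eventually.of_forall fun _ => NNReal.coe_nonneg _)
      hmeas.coe_nnreal_real.aestronglyMeasurable]
    simp
  rw [average_eq ρ (fun x => Φ.realExt (u x)), hint, smul_eq_mul, inv_mul_eq_div,
    le_div_iff₀ hMpos, realExt, hav] at hj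
  rw [← ENNReal.toReal_le_toReal (ENNReal.mul_ne_top ENNReal.coe_ne_top (measure_ne_top _ _)) htop,
    ENNReal.toReal_mul]
  exact hj

end YoungFunction

/-! ### Orlicz spaces over a finite measure: inclusion in `L¹`, dominated convergence. -/

section Orlicz

variable {α : Type*} [MeasurableSpace α] {m : Measure α} {Φ : YoungFunction}

theorem modular_antitone (f : α → ℂ) {j k : ℝ≥0} (hj : 0 < j) (hjk : j ≤ k) :
    modular Φ m f k ≤ modular Φ m f j :=
  lintegral_mono fun x => ENNReal.coe_le_coe.2 (Φ.mono (by gcongr))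

theorem luxemburg_mono {f g : α → ℂ} (h : ∀ᵐ x ∂m, ‖f x‖ ≤ ‖g x‖) :
    luxemburg Φ m f ≤ luxemburg Φ m g := by
  refine le_iInf₂ fun k hk => luxemburg_le hk.1 (le_trans (lintegral_mono_ae ?_) hk.2)
  filter_upwards [h] with x hx
  have : ‖f x‖₊ ≤ ‖g x‖₊ := hx
  exact ENNReal.coe_le_coe.2 (Φ.mono (by gcongr))

/-- `Φ` grows at least linearly and `m` is finite, so `L^Φ ⊆ L¹`. Fubini's theorem thus applies to
every element of `L^Φ`. -/
theorem integrable_of_luxemburg [IsFiniteMeasure m] {f : α → ℂ} (hf : AEStronglyMeasurable f m)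
    (h : luxemburg Φ m f < ∞) : Integrable f m := by
  obtain ⟨k, hk, hk1, -⟩ := exists_of_luxemburg_lt h
  obtain ⟨y, hy⟩ := Φ.exists_le_add_mul
  refine ⟨hf, ?_⟩
  have hmeas : AEMeasurable (fun x => (Φ (‖f x‖₊ / k) : ℝ≥0∞)) m :=
    (Φ.measurable.comp_aemeasurable (hf.aemeasurable.nnnorm.div_const k)).coe_nnreal_ennreal
  calc ∫⁻ x, ‖f x‖ₑ ∂m ≤ ∫⁻ x, ((k * y : ℝ≥0) + (k * y : ℝ≥0) * (Φ (‖f x‖₊ / k) : ℝ≥0∞)) ∂m := by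
        refine lintegral_mono fun x => ?_
        simp only [enorm_eq_nnnorm]
        norm_cast
        have := hy (‖f x‖₊ / k)
        rw [div_le_iff₀ hk] at this
        exact this.trans_eq (by ring)
    _ = (k * y : ℝ≥0) * m univ + (k * y : ℝ≥0) * modular Φ m f k := by
        rw [lintegral_add_left measurable_const, lintegral_const,
          lintegral_const_mul'' _ hmeas]; rfl
    _ < ∞ := ENNReal.add_lt_top.2 ⟨ENNReal.mul_lt_top ENNReal.coe_lt_top (measure_lt_top _ _),
        ENNReal.mul_lt_top ENNReal.coe_lt_top (hk1.trans_lt ENNReal.one_lt_top)⟩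

/-- The constant `C` absorbs the range `x ≤ x₀`; it is harmless because it is integrated against a
finite measure. -/
theorem YoungFunction.DeltaTwo.exists_le (hΦ : Φ.DeltaTwo) :
    ∃ K C : ℝ≥0, ∀ x, Φ (2 * x) ≤ K * Φ x + C := by
  obtain ⟨K, x₀, -, -, h⟩ := hΦ
  refine ⟨K, Φ (2 * x₀), fun x => ?_⟩
  rcases le_total x₀ x with hx | hx
  · exact (h x hx).trans (by simp)
  · exact (Φ.mono (by gcongr)).trans (le_add_of_nonneg_left zero_le)

/-- Under the `Δ₂`-condition, all modulars of a function in the Orlicz space are finite. -/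
theorem modular_lt_top [IsFiniteMeasure m] (hΦ : Φ.DeltaTwo) {f : α → ℂ} (hf : AEMeasurable f m)
    (h : luxemburg Φ m f < ∞) {k : ℝ≥0} (hk : 0 < k) : modular Φ m f k < ∞ := by
  obtain ⟨j, hj, hj1, -⟩ := exists_of_luxemburg_lt h
  obtain ⟨K, C, hKC⟩ := hΦ.exists_le
  -- Each halving of the scale costs one application of `Δ₂`, and `j / 2 ^ n` eventually drops below
  -- `k`.
  have hn : ∀ n : ℕ, modular Φ m f (j / 2 ^ n) < ∞ := by
    intro n
    induction n with
    | zero => simpa using hj1.trans_lt ENNReal.one_lt_top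
    | succ n ih =>
      have hmeas : AEMeasurable (fun x => (Φ (‖f x‖₊ / (j / 2 ^ n)) : ℝ≥0∞)) m :=
        (Φ.measurable.comp_aemeasurable (hf.nnnorm.div_const _)).coe_nnreal_ennreal
      calc modular Φ m f (j / 2 ^ (n + 1))
          ≤ ∫⁻ x, (K * (Φ (‖f x‖₊ / (j / 2 ^ n)) : ℝ≥0∞) + C) ∂m := by
            refine lintegral_mono fun x => ?_
            have h1 : ‖f x‖₊ / (j / 2 ^ (n + 1)) = 2 * (‖f x‖₊ / (j / 2 ^ n)) := by
              field_simp
              ring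
            rw [h1, ← ENNReal.coe_mul, ← ENNReal.coe_add]
            exact ENNReal.coe_le_coe.2 (hKC _)
        _ = K * modular Φ m f (j / 2 ^ n) + C * m univ := by
            rw [lintegral_add_right _ measurable_const, lintegral_const,
              lintegral_const_mul'' _ hmeas]; rfl
        _ < ∞ := ENNReal.add_lt_top.2 ⟨ENNReal.mul_lt_top ENNReal.coe_lt_top ih,
            ENNReal.mul_lt_top ENNReal.coe_lt_top (measure_lt_top _ _)⟩
  obtain ⟨n, hn'⟩ := pow_unbounded_of_one_lt (j / k) (one_lt_two : (1 : ℝ≥0) < 2)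
  refine (modular_antitone f (by positivity) ?_).trans_lt (hn n)
  rw [div_le_iff₀ (by positivity)]
  rw [div_lt_iff₀ hk] at hn'
  exact hn'.le.trans_eq (mul_comm _ _)

/-- Dominated convergence in the Orlicz space. -/
theorem tendsto_luxemburg_zero [IsFiniteMeasure m] (hΦ : Φ.DeltaTwo) {ι : Type*} {l : Filter ι}
    [l.IsCountablyGenerated] {g : α → ℂ} (hg : AEMeasurable g m) (hgΦ : luxemburg Φ m g < ∞)
    {F : ι → α → ℂ} (hF : ∀ i, AEMeasurable (F i) m) (hFg : ∀ i, ∀ᵐ x ∂m, ‖F i x‖ ≤ ‖g x‖)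
    (hlim : ∀ᵐ x ∂m, Tendsto (fun i => F i x) l (𝓝 0)) :
    Tendsto (fun i => luxemburg Φ m (F i)) l (𝓝 0) := by
  -- Finiteness of every modular of `g` makes `Φ(|g| / k)` an integrable majorant at each scale `k`.
  -- Modulars tending to `0` at all scales force the norm to `0`.
  have hmod : ∀ k : ℝ≥0, 0 < k → Tendsto (fun i => modular Φ m (F i) k) l (𝓝 0) := by
    intro k hk
    have h0 : ∫⁻ _, (0 : ℝ≥0∞) ∂m = 0 := by simp
    rw [← h0]
    refine tendsto_lintegral_filter_of_dominated_convergence'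
      (fun x => (Φ (‖g x‖₊ / k) : ℝ≥0∞)) (Eventually.of_forall fun i =>
        (Φ.measurable.comp_aemeasurable ((hF i).nnnorm.div_const k)).coe_nnreal_ennreal)
      (Eventually.of_forall fun i => ?_) (modular_lt_top hΦ hg hgΦ hk).ne ?_
    · filter_upwards [hFg i] with x hx
      have : ‖F i x‖₊ ≤ ‖g x‖₊ := hx
      exact ENNReal.coe_le_coe.2 (Φ.mono (by gcongr))
    · filter_upwards [hlim] with x hx
      have hc : Continuous fun z : ℂ => (Φ (‖z‖₊ / k) : ℝ≥0∞) :=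
        ENNReal.continuous_coe.comp (Φ.continuous.comp (continuous_nnnorm.div_const k))
      have h0 := (hc.tendsto 0).comp hx
      rw [nnnorm_zero, zero_div, Φ.map_zero', ENNReal.coe_zero] at h0
      exact h0
  rw [ENNReal.tendsto_nhds_zero]
  intro ε hε
  obtain ⟨k, hk, hkε⟩ := ENNReal.lt_iff_exists_nnreal_btwn.1 hε
  have hk0 : 0 < k := by exact_mod_cast hk
  filter_upwards [(hmod k hk0).eventually_le_const one_pos] with i hi
  exact (luxemburg_le hk0 hi).trans hkε.le

theorem luxemburg_const_lt_top [IsFiniteMeasure m] (c : ℂ) : luxemburg Φ m (fun _ => c) < ∞ := by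
  have h := luxemburg_const_mul_le (Φ := Φ) (m := m) c (univ.indicator fun _ => 1)
  simp only [indicator_univ, mul_one] at h
  have h1 := luxemburg_indicator_lt_top (Φ := Φ) (m := m) univ
  simp only [indicator_univ] at h1
  exact h.trans_lt (ENNReal.mul_lt_top ENNReal.coe_lt_top h1)

namespace Orlicz

/-- The class of a function with finite Luxemburg norm. -/
noncomputable def mk (f : α → ℂ) (hf : AEStronglyMeasurable f m) (h : luxemburg Φ m f < ∞) :
    Orlicz Φ m :=
  ⟨AEEqFun.mk f hf, (luxemburg_congr (AEEqFun.coeFn_mk f hf)).trans_lt h⟩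

theorem coeFn_mk (f : α → ℂ) (hf : AEStronglyMeasurable f m) (h : luxemburg Φ m f < ∞) :
    (mk f hf h : Orlicz Φ m) =ᵐ[m] f := AEEqFun.coeFn_mk f hf

theorem coeFn_chi [IsFiniteMeasure m] (A : Set α) (hA : MeasurableSet A) :
    chi Φ m A hA =ᵐ[m] A.indicator fun _ => 1 := AEEqFun.coeFn_mk _ _

theorem coeFn_zero : ((0 : Orlicz Φ m) : α → ℂ) =ᵐ[m] 0 := AEEqFun.coeFn_zero

theorem coeFn_sub (f g : Orlicz Φ m) : (f - g) =ᵐ[m] fun x => f x - g x :=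
  AEEqFun.coeFn_sub f.1 g.1

theorem ext {f g : Orlicz Φ m} (h : f =ᵐ[m] g) : f = g := Subtype.ext (AEEqFun.ext h)

theorem luxemburg_lt_top (f : Orlicz Φ m) : luxemburg Φ m f < ∞ := f.2

theorem measurable (f : Orlicz Φ m) : Measurable f := f.1.stronglyMeasurable.measurable

theorem integrable [IsFiniteMeasure m] (f : Orlicz Φ m) : Integrable f m :=
  integrable_of_luxemburg f.measurable.aestronglyMeasurable f.luxemburg_lt_top

theorem norm_le_of_ae_le {f g : Orlicz Φ m} (h : ∀ᵐ x ∂m, ‖f x‖ ≤ ‖g x‖) : ‖f‖ ≤ ‖g‖ :=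
  ENNReal.toReal_mono g.luxemburg_lt_top.ne (luxemburg_mono h)

/-- Dominated convergence for sequences of elements of the Orlicz space. -/
theorem tendsto_of_dominated [IsFiniteMeasure m] (hΦ : Φ.DeltaTwo) {ι : Type*} {l : Filter ι}
    [l.IsCountablyGenerated] {F : ι → Orlicz Φ m} {f : Orlicz Φ m} {g : α → ℂ}
    (hg : AEMeasurable g m) (hgΦ : luxemburg Φ m g < ∞)
    (hFg : ∀ i, ∀ᵐ x ∂m, ‖F i x - f x‖ ≤ ‖g x‖)
    (hlim : ∀ᵐ x ∂m, Tendsto (fun i => F i x) l (𝓝 (f x))) : Tendsto F l (𝓝 f) := by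
  rw [tendsto_iff_norm_sub_tendsto_zero]
  have h := tendsto_luxemburg_zero hΦ hg hgΦ
    (fun i => (F i).aemeasurable.sub f.aemeasurable) hFg
    (hlim.mono fun x hx => by simpa using hx.sub_const (f x))
  refine ((ENNReal.tendsto_toReal ENNReal.zero_ne_top).comp h).congr fun i => ?_
  rw [norm_def, luxemburg_congr (coeFn_sub (F i) f)]
  rfl

end Orlicz

end Orlicz
-- The vector measure of a bounded operator on `L^Φ`, and the inclusion in its `L¹`.
section AssociatedMeasure

variable {α : Type*} [MeasurableSpace α] {m : Measure α} [IsFiniteMeasure m] {Φ : YoungFunction}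
  {X : Type*} [NormedAddCommGroup X] [NormedSpace ℂ X]

/-- Partial sums differ from the limit by at most `1` in modulus, and constants lie in `L^Φ`, so
dominated convergence applies. This is the `σ`-additivity of `A ↦ T χ_A`. -/
theorem Orlicz.hasSum_chi (hΦ : Φ.DeltaTwo) {A : ℕ → Set α} (hA : ∀ i, MeasurableSet (A i))
    (hd : Pairwise (Function.onFun Disjoint A)) :
    HasSum (fun i => chi Φ m (A i) (hA i)) (chi Φ m (⋃ i, A i) (.iUnion hA)) := by
  have hsum : ∀ s : Finset ℕ, (∑ i ∈ s, chi Φ m (A i) (hA i) : Orlicz Φ m) =ᵐ[m]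
      fun x => ∑ i ∈ s, (A i).indicator (fun _ => (1 : ℂ)) x := by
    intro s
    classical
    induction s using Finset.induction_on with
    | empty => exact Orlicz.coeFn_zero.trans (by simp; rfl)
    | insert i s hi ih =>
      rw [Finset.sum_insert hi]
      filter_upwards [coeFn_add (chi Φ m (A i) (hA i)) (∑ i ∈ s, chi Φ m (A i) (hA i)), ih,
        coeFn_chi (Φ := Φ) (m := m) (A i) (hA i)] with x h1 h2 h3
      rw [h1, h2, h3, Finset.sum_insert hi]
  refine tendsto_of_dominated hΦ (g := fun _ => 1) measurable_const.aemeasurable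
    (luxemburg_const_lt_top 1) (fun s => ?_) ?_
  · filter_upwards [hsum s, coeFn_chi (Φ := Φ) (m := m) (⋃ i, A i) (.iUnion hA)] with x h1 h2
    rw [h1, h2, ← Finset.indicator_biUnion_apply]
    · by_cases hx : x ∈ ⋃ i ∈ s, A i
      · have hx' : x ∈ ⋃ i, A i := iUnion₂_subset_iUnion _ _ hx
        simp [hx, hx']
      · rw [indicator_of_notMem hx]
        by_cases hx' : x ∈ ⋃ i, A i <;> simp [hx']
    · exact fun i _ j _ hij => hd hij
  -- `ℕ` has only countably many finite subsets, so one null set serves all partial sums.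
  · have hall : ∀ᵐ x ∂m, ∀ s : Finset ℕ, (∑ i ∈ s, chi Φ m (A i) (hA i) : Orlicz Φ m) x =
        ∑ i ∈ s, (A i).indicator (fun _ => (1 : ℂ)) x := ae_all_iff.2 hsum
    filter_upwards [hall, coeFn_chi (Φ := Φ) (m := m) (⋃ i, A i) (.iUnion hA)] with x h1 h2
    simp only [h1]
    rw [h2]
    by_cases hx : x ∈ ⋃ i, A i
    · obtain ⟨j, hj⟩ := mem_iUnion.1 hx
      have h3 := hasSum_single (f := fun i => (A i).indicator (fun _ => (1 : ℂ)) x) j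
        fun i hij => indicator_of_notMem (disjoint_left.1 (hd hij.symm) hj) _
      rw [indicator_of_mem hx]
      simpa only [indicator_of_mem hj] using! h3
    · rw [indicator_of_notMem hx]
      have h3 : ∀ i, (A i).indicator (fun _ => (1 : ℂ)) x = 0 := fun i =>
        indicator_of_notMem (fun h => hx (mem_iUnion.2 ⟨i, h⟩)) _
      simp only [h3, Finset.sum_const_zero]
      exact tendsto_const_nhds

/-- The vector measure `A ↦ T χ_A`. -/
noncomputable def assocMeasure (hΦ : Φ.DeltaTwo) (T : Orlicz Φ m →L[ℂ] X) : VectorMeasure α X where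
  measureOf' A := by
    classical exact if hA : MeasurableSet A then T (Orlicz.chi Φ m A hA) else 0
  empty' := by
    rw [dif_pos MeasurableSet.empty]
    have : Orlicz.chi Φ m ∅ MeasurableSet.empty = 0 := by
      refine Orlicz.ext ((Orlicz.coeFn_chi _ _).trans ?_)
      rw [indicator_empty]
      exact Orlicz.coeFn_zero.symm
    rw [this, map_zero]
  not_measurable' A hA := dif_neg hA
  m_iUnion' A hA hd := by
    simp only [hA, MeasurableSet.iUnion hA, dif_pos]
    exact T.hasSum (Orlicz.hasSum_chi hΦ hA hd)

theorem assocMeasure_apply (hΦ : Φ.DeltaTwo) (T : Orlicz Φ m →L[ℂ] X) (A : Set α)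
    (hA : MeasurableSet A) : assocMeasure hΦ T A = T (Orlicz.chi Φ m A hA) := dif_pos hA

variable {T : Orlicz Φ m →L[ℂ] X} {ν : VectorMeasure α X}

/-- `χ_A` is zero in `L^Φ` when `A` is `m`-null. This makes the inclusion well defined on classes.
-/
theorem variation_absolutelyContinuous (hν : ∀ A hA, ν A = T (Orlicz.chi Φ m A hA))
    (ℓ : StrongDual ℂ X) : (scalarMeasure ν ℓ).variation ≪ m := by
  refine Measure.AbsolutelyContinuous.mk fun A hA h0 => ?_
  by_contra hne
  obtain ⟨P, hP, -, hPm, hlt⟩ := VectorMeasure.exists_lt_sum_of_lt_variation _ hA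
    (pos_iff_ne_zero.2 hne)
  refine hlt.ne' (Finset.sum_eq_zero fun p hp => ?_)
  have : Orlicz.chi Φ m p (hPm p hp) = 0 := by
    refine Orlicz.ext ((Orlicz.coeFn_chi _ _).trans (EventuallyEq.trans ?_ Orlicz.coeFn_zero.symm))
    exact indicator_meas_zero (measure_mono_null (hP p hp) h0)
  rw [scalarMeasure_apply, hν p (hPm p hp), this, map_zero, map_zero, enorm_zero]

theorem luxemburg_lt_top_of_bound {f : α → ℂ} {C : ℝ} (h : ∀ x, ‖f x‖ ≤ C) :
    luxemburg Φ m f < ∞ :=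
  (luxemburg_mono (g := fun _ => (C : ℂ)) (Eventually.of_forall fun x => (h x).trans
    (by simpa using le_abs_self C))).trans_lt (luxemburg_const_lt_top _)

theorem luxemburg_simpleFunc_lt_top (s : SimpleFunc α ℂ) : luxemburg Φ m s < ∞ := by
  obtain ⟨C, hC⟩ := s.exists_forall_norm_le
  exact luxemburg_lt_top_of_bound hC

theorem integral_simpleFunc (hν : ∀ A hA, ν A = T (Orlicz.chi Φ m A hA)) (ℓ : StrongDual ℂ X)
    (s : SimpleFunc α ℂ) (g : Orlicz Φ m) (hg : g =ᵐ[m] s) :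
    (scalarMeasure ν ℓ).integral s (ContinuousLinearMap.mul ℝ ℂ) = ℓ (T g) := by
  have := isFiniteMeasure_variation (scalarMeasure ν ℓ)
  induction s using SimpleFunc.induction generalizing g with
  | const c hs =>
    rename_i A
    have h1 : g = c • Orlicz.chi Φ m A hs := by
      refine Orlicz.ext ?_
      filter_upwards [hg, Orlicz.coeFn_smul c (Orlicz.chi Φ m A hs),
        Orlicz.coeFn_chi (Φ := Φ) (m := m) A hs] with x h1 h2 h3
      rw [h1, h2, h3]
      by_cases hx : x ∈ A <;> simp [hx]
    have h2 : ((SimpleFunc.piecewise A hs (SimpleFunc.const α c) (SimpleFunc.const α 0) :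
        SimpleFunc α ℂ) : α → ℂ) = A.indicator fun _ => c := by
      ext x; by_cases hx : x ∈ A <;> simp [hx]
    rw [h2, VectorMeasure.integral_indicator_const c hs, h1, map_smul, map_smul,
      scalarMeasure_apply, hν A hs]
    rfl
  | @add s t _ hs ht =>
    have h1 := hs (Orlicz.mk s s.aestronglyMeasurable (luxemburg_simpleFunc_lt_top s))
      (Orlicz.coeFn_mk _ _ _)
    have h2 := ht (Orlicz.mk t t.aestronglyMeasurable (luxemburg_simpleFunc_lt_top t))
      (Orlicz.coeFn_mk _ _ _)
    have h3 : g = Orlicz.mk s s.aestronglyMeasurable (luxemburg_simpleFunc_lt_top s) +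
        Orlicz.mk t t.aestronglyMeasurable (luxemburg_simpleFunc_lt_top t) := by
      refine Orlicz.ext ?_
      filter_upwards [hg, Orlicz.coeFn_add
        (Orlicz.mk s s.aestronglyMeasurable (luxemburg_simpleFunc_lt_top s))
        (Orlicz.mk t t.aestronglyMeasurable (luxemburg_simpleFunc_lt_top t) : Orlicz Φ m),
        Orlicz.coeFn_mk (Φ := Φ) (m := m) s s.aestronglyMeasurable (luxemburg_simpleFunc_lt_top s),
        Orlicz.coeFn_mk (Φ := Φ) (m := m) t t.aestronglyMeasurable (luxemburg_simpleFunc_lt_top t)]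
        with x h1 h2 h3 h4
      rw [h1, h2, h3, h4]; rfl
    rw [h3, map_add, map_add, ← h1, ← h2, SimpleFunc.coe_add]
    exact VectorMeasure.integral_add (SimpleFunc.integrable_of_isFiniteMeasure s)
      (SimpleFunc.integrable_of_isFiniteMeasure t)

/-- Simple approximations of `f` converge in both senses: their integrals by dominated convergence
for `|⟨ν, ℓ⟩|`, their classes in `L^Φ` by `Δ₂`. -/
theorem integral_eq_of_integrable (hΦ : Φ.DeltaTwo)
    (hν : ∀ A hA, ν A = T (Orlicz.chi Φ m A hA)) (ℓ : StrongDual ℂ X) {f : α → ℂ}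
    (hfm : Measurable f) (hf : (scalarMeasure ν ℓ).Integrable f) (g : Orlicz Φ m)
    (hg : g =ᵐ[m] f) :
    (scalarMeasure ν ℓ).integral f (ContinuousLinearMap.mul ℝ ℂ) = ℓ (T g) := by
  set s : ℕ → SimpleFunc α ℂ := fun n => SimpleFunc.approxOn f hfm univ 0 (mem_univ 0) n
  have hs1 : ∀ n x, ‖s n x‖ ≤ ‖f x‖ + ‖f x‖ := fun n x =>
    SimpleFunc.norm_approxOn_zero_le hfm (mem_univ 0) x n
  have hs2 : ∀ x, Tendsto (fun n => s n x) atTop (𝓝 (f x)) := fun x =>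
    SimpleFunc.tendsto_approxOn hfm (mem_univ 0) (by simp)
  set S : ℕ → Orlicz Φ m := fun n =>
    Orlicz.mk (s n) (s n).aestronglyMeasurable (luxemburg_simpleFunc_lt_top _)
  have hS : ∀ᵐ x ∂m, ∀ n, S n x = s n x := ae_all_iff.2 fun n => Orlicz.coeFn_mk _ _ _
  have h1 : Tendsto (fun n => (scalarMeasure ν ℓ).integral (s n) (ContinuousLinearMap.mul ℝ ℂ))
      atTop (𝓝 ((scalarMeasure ν ℓ).integral f (ContinuousLinearMap.mul ℝ ℂ))) :=
    VectorMeasure.tendsto_integral_of_dominated_convergence (fun x => ‖f x‖ + ‖f x‖)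
      (fun n => (s n).aestronglyMeasurable) (hf.norm.add hf.norm)
      (fun n => Eventually.of_forall (hs1 n)) (Eventually.of_forall hs2)
  have h2 : Tendsto S atTop (𝓝 g) := by
    -- The approximants satisfy `|s n| ≤ 2|f|`, hence `|s n - f| ≤ 3|f|`.
    refine Orlicz.tendsto_of_dominated hΦ (g := fun x => (3 : ℂ) * g x)
      (g.aemeasurable.const_mul _) ?_ (fun n => ?_) ?_
    · rw [luxemburg_const_mul]
      exact ENNReal.mul_lt_top ENNReal.coe_lt_top g.luxemburg_lt_top
    · filter_upwards [hS, hg] with x hx hx'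
      rw [hx, hx', norm_mul]
      refine (norm_sub_le _ _).trans ?_
      have := hs1 n x
      norm_num
      linarith
    · filter_upwards [hS, hg] with x hx hx'
      simp only [hx, hx', hs2 x]
  refine tendsto_nhds_unique h1 ?_
  refine (((ℓ.continuous.comp T.continuous).tendsto g).comp h2).congr fun n => ?_
  exact (integral_simpleFunc hν ℓ (s n) (S n) (Orlicz.coeFn_mk _ _ _)).symm

/-- With `h` the polar density, `w = |f| h̄` satisfies `∫ w d⟨ν, ℓ⟩ = ∫ |f| d|⟨ν, ℓ⟩|`, and the left
side is `ℓ (T w)`. Boundedness provides integrability in advance. Requiring only `|f| ≤ |g|` lets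
one `g` serve all truncations of a function. -/
theorem lintegral_le_of_bounded (hΦ : Φ.DeltaTwo)
    (hν : ∀ A hA, ν A = T (Orlicz.chi Φ m A hA)) (ℓ : StrongDual ℂ X) {f : α → ℂ}
    (hfm : Measurable f) {C : ℝ} (hC : ∀ x, ‖f x‖ ≤ C) (g : Orlicz Φ m)
    (hg : ∀ᵐ x ∂m, ‖f x‖ ≤ ‖g x‖) :
    ∫⁻ x, ‖f x‖ₑ ∂(scalarMeasure ν ℓ).variation ≤ ENNReal.ofReal (‖ℓ‖ * (‖T‖ * ‖g‖)) := by
  have := isFiniteMeasure_variation (scalarMeasure ν ℓ)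
  obtain ⟨h, hm, hi, hn, hμ⟩ := exists_polar (scalarMeasure ν ℓ)
  set w : α → ℂ := fun x => ‖f x‖ * (starRingEnd ℂ) (h x) with hw
  have hwn : ∀ x, ‖w x‖ = ‖f x‖ := fun x => by simp [hw, hn]
  have hwm : Measurable w := by
    have h1 : Measurable fun x => (starRingEnd ℂ) (h x) := Complex.continuous_conj.measurable.comp hm
    have h2 : Measurable fun x => ((‖f x‖ : ℝ) : ℂ) := Complex.measurable_ofReal.comp hfm.norm
    exact h2.mul h1
  have hwΦ : luxemburg Φ m w < ∞ := luxemburg_lt_top_of_bound fun x => (hwn x).trans_le (hC x)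
  have hwi : (scalarMeasure ν ℓ).Integrable w :=
    Integrable.of_bound (μ := (scalarMeasure ν ℓ).variation) hwm.aestronglyMeasurable C
      (Eventually.of_forall fun x => (hwn x).trans_le (hC x))
  have hmk := Orlicz.coeFn_mk (Φ := Φ) w hwm.aestronglyMeasurable hwΦ
  have h1 := integral_eq_of_integrable hΦ hν ℓ hwm hwi _ hmk
  rw [integral_eq_integral_mul hi hn hμ hwi] at h1
  have h2 : ∀ x, w x * h x = ((‖f x‖ : ℝ) : ℂ) := fun x => by
    rw [hw, mul_assoc, mul_comm _ (h x), Complex.mul_conj, Complex.normSq_eq_norm_sq, hn]; simp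
  simp only [h2] at h1
  rw [integral_complex_ofReal] at h1
  have hfi : Integrable f (scalarMeasure ν ℓ).variation :=
    Integrable.of_bound hfm.aestronglyMeasurable C (Eventually.of_forall hC)
  rw [← ofReal_integral_norm_eq_lintegral_enorm hfi]
  refine ENNReal.ofReal_le_ofReal ?_
  have h3 : ‖Orlicz.mk w hwm.aestronglyMeasurable hwΦ‖ ≤ ‖g‖ := by
    refine Orlicz.norm_le_of_ae_le ?_
    filter_upwards [hmk, hg] with x hx hx'
    rwa [hx, hwn]
  calc ∫ x, ‖f x‖ ∂(scalarMeasure ν ℓ).variation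
      ≤ ‖((∫ x, ‖f x‖ ∂(scalarMeasure ν ℓ).variation : ℝ) : ℂ)‖ := by
        rw [Complex.norm_real]; exact le_abs_self _
    _ ≤ ‖ℓ‖ * (‖T‖ * ‖g‖) := by
        rw [h1]
        refine (ℓ.le_opNorm _).trans ?_
        gcongr
        exact (T.le_opNorm _).trans (by gcongr)

/-- Truncation at height `n` and Fatou's lemma remove the boundedness assumption. -/
theorem lintegral_le (hΦ : Φ.DeltaTwo) (hν : ∀ A hA, ν A = T (Orlicz.chi Φ m A hA))
    (ℓ : StrongDual ℂ X) {f : α → ℂ} (hfm : Measurable f) (g : Orlicz Φ m) (hg : g =ᵐ[m] f) :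
    ∫⁻ x, ‖f x‖ₑ ∂(scalarMeasure ν ℓ).variation ≤ ENNReal.ofReal (‖ℓ‖ * (‖T‖ * ‖g‖)) := by
  set F : ℕ → α → ℂ := fun n => {x | ‖f x‖ ≤ n}.indicator f
  have hFm : ∀ n, Measurable (F n) := fun n =>
    hfm.indicator (measurableSet_le hfm.norm measurable_const)
  have hlim : ∀ x, ‖f x‖ₑ = liminf (fun n => ‖F n x‖ₑ) atTop := by
    intro x
    have : Tendsto (fun n => ‖F n x‖ₑ) atTop (𝓝 ‖f x‖ₑ) := by
      refine tendsto_const_nhds.congr' ?_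
      filter_upwards [eventually_ge_atTop ⌈‖f x‖⌉₊] with n hn
      have : x ∈ {x | ‖f x‖ ≤ n} := Nat.ceil_le.1 hn
      simp only [F, indicator_of_mem this]
    exact this.liminf_eq.symm
  simp only [hlim]
  refine (lintegral_liminf_le fun n => (hFm n).enorm).trans ?_
  refine liminf_le_of_le (by isBoundedDefault) fun b hb => ?_
  obtain ⟨n, hn⟩ := hb.exists
  refine hn.trans (lintegral_le_of_bounded hΦ hν ℓ (hFm n) (C := n) (fun x => ?_) g ?_)
  · by_cases hx : x ∈ {x | ‖f x‖ ≤ n}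
    · simp only [F, indicator_of_mem hx]; exact hx
    · simp [F, indicator_of_notMem hx]
  · filter_upwards [hg] with x hx
    rw [hx]
    exact norm_indicator_le_norm_self _ _

theorem vNorm_le (hΦ : Φ.DeltaTwo) (hν : ∀ A hA, ν A = T (Orlicz.chi Φ m A hA))
    {f : α → ℂ} (hfm : Measurable f) (g : Orlicz Φ m) (hg : g =ᵐ[m] f) :
    vNorm ν f ≤ ENNReal.ofReal (‖T‖ * ‖g‖) := by
  refine iSup₂_le fun ℓ hℓ => (lintegral_le hΦ hν ℓ hfm g hg).trans ?_
  exact ENNReal.ofReal_le_ofReal (mul_le_of_le_one_left (by positivity) hℓ)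

/-- The vector representing `∫_A f dν` is `T (f χ_A)`. -/
theorem isVIntegrable (hΦ : Φ.DeltaTwo) (hν : ∀ A hA, ν A = T (Orlicz.chi Φ m A hA))
    {f : α → ℂ} (hfm : Measurable f) (g : Orlicz Φ m) (hg : g =ᵐ[m] f) : IsVIntegrable ν f := by
  have hint : ∀ ℓ : StrongDual ℂ X, (scalarMeasure ν ℓ).Integrable f := fun ℓ =>
    ⟨hfm.aestronglyMeasurable, (lintegral_le hΦ hν ℓ hfm g hg).trans_lt ENNReal.ofReal_lt_top⟩
  refine ⟨⟨hfm, hint⟩, fun A hA => ?_⟩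
  have hΦA : luxemburg Φ m (A.indicator f) < ∞ :=
    (luxemburg_mono (hg.mono fun x hx => by
      rw [hx]; exact norm_indicator_le_norm_self _ _)).trans_lt g.luxemburg_lt_top
  refine ⟨T (Orlicz.mk (A.indicator f) (hfm.indicator hA).aestronglyMeasurable hΦA), fun ℓ => ?_⟩
  rw [← VectorMeasure.integral_indicator hA]
  exact integral_eq_of_integrable hΦ hν ℓ (hfm.indicator hA)
    (MeasureTheory.Integrable.indicator (hint ℓ) hA) _ (Orlicz.coeFn_mk _ _ _)

theorem vNorm_eq_zero_of_ae (hν : ∀ A hA, ν A = T (Orlicz.chi Φ m A hA)) {f : α → ℂ}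
    (hf : f =ᵐ[m] 0) : vNorm ν f = 0 := by
  refine le_antisymm (iSup₂_le fun ℓ _ => ?_) zero_le
  rw [lintegral_congr_ae (g := fun _ => 0)]
  · simp
  · filter_upwards [(variation_absolutelyContinuous hν ℓ).ae_le hf] with x hx
    simp [hx]

theorem VL1.mk_eq_mk (hν : ∀ A hA, ν A = T (Orlicz.chi Φ m A hA)) {f g : α → ℂ}
    (hf : IsVIntegrable ν f) (hg : IsVIntegrable ν g) (h : f =ᵐ[m] g) :
    VL1.mk f hf = VL1.mk g hg := by
  refine SeparationQuotient.mk_eq_mk.2 (Metric.inseparable_iff.2 ?_)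
  have h0 : vNorm ν (fun x => f x - g x) = 0 := by
    refine vNorm_eq_zero_of_ae hν ?_
    filter_upwards [h] with x hx
    rw [hx, sub_self, Pi.zero_apply]
  have h1 : dist (α := PreL1 ν) ⟨f, hf⟩ ⟨g, hg⟩ = (vNorm ν fun x => f x - g x).toReal :=
    dist_eq_norm _ _
  refine h1.trans ?_
  rw [h0, ENNReal.toReal_zero]

theorem VL1.norm_mk (f : α → ℂ) (hf : IsVIntegrable ν f) :
    ‖VL1.mk f hf‖ = (vNorm ν f).toReal := rfl

/-- The inclusion of the Orlicz space in `L¹(ν)`, for the measure `ν : A ↦ T χ_A`. -/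
noncomputable def inclusion (hΦ : Φ.DeltaTwo) (hν : ∀ A hA, ν A = T (Orlicz.chi Φ m A hA)) :
    Orlicz Φ m →L[ℂ] VL1 ν :=
  LinearMap.mkContinuous
    { toFun := fun f => VL1.mk f (isVIntegrable hΦ hν f.measurable f (ae_eq_refl _))
      map_add' := fun f g =>
        (VL1.mk_eq_mk hν _ ((integrableSubmodule ν).add_mem
          (isVIntegrable hΦ hν f.measurable f (ae_eq_refl _))
          (isVIntegrable hΦ hν g.measurable g (ae_eq_refl _))) (Orlicz.coeFn_add f g)).trans rfl
      map_smul' := fun c f =>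
        (VL1.mk_eq_mk hν _ ((integrableSubmodule ν).smul_mem c
          (isVIntegrable hΦ hν f.measurable f (ae_eq_refl _))) (Orlicz.coeFn_smul c f)).trans rfl }
    ‖T‖ fun f => ENNReal.toReal_le_of_le_ofReal (by positivity)
      (vNorm_le hΦ hν f.measurable f (ae_eq_refl _))

theorem inclusion_apply (hΦ : Φ.DeltaTwo) (hν : ∀ A hA, ν A = T (Orlicz.chi Φ m A hA))
    (f : Orlicz Φ m) {g : α → ℂ} (hg : IsVIntegrable ν g) (h : g =ᵐ[m] f) :
    inclusion hΦ hν f = VL1.mk g hg :=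
  VL1.mk_eq_mk hν (isVIntegrable hΦ hν f.measurable f (ae_eq_refl _)) hg h.symm

theorem norm_inclusion_le (hΦ : Φ.DeltaTwo) (hν : ∀ A hA, ν A = T (Orlicz.chi Φ m A hA)) :
    ‖inclusion hΦ hν‖ ≤ ‖T‖ :=
  LinearMap.mkContinuous_norm_le _ (norm_nonneg T) _

/-- The inclusion in `L¹(ν)` is injective if `T` does not annihilate characteristic functions of
sets of positive measure. -/
theorem inclusion_injective (hΦ : Φ.DeltaTwo) (hν : ∀ A hA, ν A = T (Orlicz.chi Φ m A hA))
    (hT : ∀ A hA, T (Orlicz.chi Φ m A hA) = 0 → m A = 0) :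
    Function.Injective (inclusion hΦ hν) := by
  rw [injective_iff_map_eq_zero]
  intro f hf
  have h0 : vNorm ν f = 0 := by
    have h1 : ‖inclusion hΦ hν f‖ = (vNorm ν f).toReal := rfl
    rw [hf, norm_zero] at h1
    exact ((ENNReal.toReal_eq_zero_iff _).1 h1.symm).resolve_right
      (vNorm_lt_top (isVIntegrable hΦ hν f.measurable f (ae_eq_refl _)).1).ne
  have hE : MeasurableSet {x | f x ≠ 0} := (f.measurable (measurableSet_singleton 0)).compl
  have hz : ∀ ℓ : StrongDual ℂ X, ‖ℓ‖ ≤ 1 → ℓ (ν {x | f x ≠ 0}) = 0 := by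
    intro ℓ hℓ
    have h1 : ∫⁻ x, ‖f x‖ₑ ∂(scalarMeasure ν ℓ).variation = 0 := by
      refine le_antisymm (le_trans ?_ h0.le) zero_le
      exact le_iSup₂_of_le (f := fun (ℓ : StrongDual ℂ X) (_ : ‖ℓ‖ ≤ 1) =>
          ∫⁻ x, ‖f x‖ₑ ∂(scalarMeasure ν ℓ).variation) ℓ hℓ le_rfl
    rw [lintegral_eq_zero_iff f.measurable.enorm] at h1
    have h2 : (scalarMeasure ν ℓ).variation {x | f x ≠ 0} = 0 := by
      refine measure_mono_null (fun x hx => ?_) (ae_iff.1 h1)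
      simpa using hx
    have h3 := VectorMeasure.enorm_measure_le_variation (scalarMeasure ν ℓ) {x | f x ≠ 0}
    rw [h2] at h3
    exact enorm_eq_zero.1 (le_antisymm h3 zero_le)
  -- A norming functional from Hahn–Banach turns the vanishing of all `ℓ (ν E)` into `ν E = 0`.
  have hν0 : ν {x | f x ≠ 0} = 0 := by
    obtain ⟨ℓ, hℓ, hℓ'⟩ := exists_dual_vector'' ℂ (ν {x | f x ≠ 0})
    rw [hz ℓ hℓ] at hℓ'
    exact norm_eq_zero.1 (by simpa using hℓ'.symm)
  rw [hν _ hE] at hν0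
  refine Orlicz.ext (EventuallyEq.trans ?_ Orlicz.coeFn_zero.symm)
  exact ae_iff.2 (hT _ hE hν0)

/-- The inclusion is tested on the constant `1`, whose `ν`-norm dominates `‖ν univ‖` by means of a
norming functional. -/
theorem norm_le_norm_inclusion (hΦ : Φ.DeltaTwo)
    (hν : ∀ A hA, ν A = T (Orlicz.chi Φ m A hA)) :
    ‖T (Orlicz.chi Φ m univ .univ)‖ ≤ ‖inclusion hΦ hν‖ * ‖Orlicz.chi Φ m univ .univ‖ := by
  refine le_trans ?_ ((inclusion hΦ hν).le_opNorm _)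
  have hi : IsVIntegrable ν fun _ => (1 : ℂ) := isVIntegrable hΦ hν measurable_const
    (Orlicz.chi Φ m univ .univ) ((Orlicz.coeFn_chi _ _).trans (by simp))
  rw [inclusion_apply hΦ hν _ hi ((Orlicz.coeFn_chi _ _).trans (by simp)).symm, VL1.norm_mk]
  obtain ⟨ℓ, hℓ, hℓ'⟩ := exists_dual_vector'' ℂ (T (Orlicz.chi Φ m univ .univ))
  rw [← ENNReal.ofReal_le_iff_le_toReal (vNorm_lt_top hi.1).ne]
  have h1 := VectorMeasure.enorm_measure_le_variation (scalarMeasure ν ℓ) univ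
  rw [scalarMeasure_apply, hν univ .univ, hℓ', ← ofReal_norm] at h1
  refine (le_of_eq (by simp)).trans (h1.trans ?_)
  refine le_iSup₂_of_le (f := fun (ℓ : StrongDual ℂ X) (_ : ‖ℓ‖ ≤ 1) =>
          ∫⁻ _, ‖(1 : ℂ)‖ₑ ∂(scalarMeasure ν ℓ).variation) ℓ hℓ ?_
  simp

end AssociatedMeasure

/-! ### Baire sets and Tonelli's theorem for convolutions. -/

section Baire

/-- The topological space `G` with the `σ`-algebra of its Baire sets. -/
def BaireSpaceOf (G : Type*) : Type _ := G

variable {G : Type*} [TopologicalSpace G]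

/-- The generators are the level sets `{f = 1}` because these are the sets furnished by inner
regularity on topological groups. -/
instance : MeasurableSpace (BaireSpaceOf G) :=
  MeasurableSpace.generateFrom {s : Set G | ∃ f : G → ℝ, Continuous f ∧ s = f ⁻¹' {1}}

/-- The identity, as a map from `G` to `G` with the Baire `σ`-algebra. -/
def toBaire : G → BaireSpaceOf G := id

theorem measurable_toBaire_comp {Ω : Type*} [MeasurableSpace Ω] {q : Ω → G}
    (hq : ∀ f : G → ℝ, Continuous f → Measurable (f ∘ q)) : Measurable (toBaire ∘ q) := by
  refine measurable_generateFrom ?_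
  rintro s ⟨f, hf, rfl⟩
  exact hq f hf (measurableSet_singleton 1)

variable [MeasurableSpace G] [BorelSpace G]

theorem measurable_toBaire : Measurable (toBaire : G → BaireSpaceOf G) :=
  measurable_toBaire_comp (q := id) fun _ hf => hf.measurable

variable [Group G] [IsTopologicalGroup G] [CompactSpace G] (m : Measure G)
  [m.IsMulLeftInvariant] [m.InnerRegularCompactLTTop] [IsFiniteMeasure m]

/-- Inner regularity gives Baire subsets with measures approaching `m A`; their countable union
exhausts `A` up to a null set. -/
theorem exists_baire_subset {A : Set G} (hA : MeasurableSet A) :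
    ∃ K : Set (BaireSpaceOf G), MeasurableSet K ∧ toBaire ⁻¹' K ⊆ A ∧
      m (A \ toBaire ⁻¹' K) = 0 := by
  rcases eq_or_ne (m A) 0 with h0 | h0
  · exact ⟨∅, MeasurableSet.empty, by simp, by simpa using h0⟩
  obtain ⟨u, -, hu, hlim⟩ := exists_seq_strictMono_tendsto' (pos_iff_ne_zero.2 h0)
  have hreg := Measure.innerRegularWRT_preimage_one_hasCompactSupport_measure_ne_top_of_group
    (μ := m)
  have hex : ∀ n, ∃ K : Set (BaireSpaceOf G), MeasurableSet K ∧ toBaire ⁻¹' K ⊆ A ∧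
      u n < m (toBaire ⁻¹' K) := by
    intro n
    obtain ⟨K, hKA, ⟨f, hf, -, rfl⟩, hlt⟩ := hreg ⟨hA, measure_ne_top m A⟩ (u n) (hu n).2
    exact ⟨f ⁻¹' {1}, MeasurableSpace.measurableSet_generateFrom ⟨f, hf, rfl⟩, hKA, hlt⟩
  choose K hK hKA hlt using hex
  have hsub : toBaire ⁻¹' (⋃ n, K n) ⊆ A := by
    rw [preimage_iUnion]; exact iUnion_subset hKA
  refine ⟨⋃ n, K n, .iUnion hK, hsub, ?_⟩
  rw [measure_sdiff hsub (measurable_toBaire (.iUnion hK)).nullMeasurableSet (measure_ne_top _ _)]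
  refine tsub_eq_zero_of_le (le_of_tendsto hlim (Eventually.of_forall fun n => ?_))
  exact (hlt n).le.trans (measure_mono (preimage_mono (subset_iUnion K n)))

/-- Approximating both `A` and its complement from inside traps `A` between two Baire sets that
differ by a null set. -/
theorem nullMeasurableSet_baire {A : Set (BaireSpaceOf G)}
    (hA : MeasurableSet (toBaire ⁻¹' A : Set G)) : NullMeasurableSet A (m.map toBaire) := by
  obtain ⟨K, hK, hKA, hK0⟩ := exists_baire_subset m hA
  obtain ⟨L, hL, hLA, hL0⟩ := exists_baire_subset m hA.compl
  have h : A = K ∪ A \ K := (union_sdiff_cancel hKA).symm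
  rw [h]
  refine hK.nullMeasurableSet.union (NullMeasurableSet.of_null ?_)
  refine measure_mono_null (t := (K ∪ L)ᶜ) (fun x hx => ?_) ?_
  · rintro (h1 | h1)
    · exact hx.2 h1
    · exact hLA h1 hx.1
  · rw [Measure.map_apply measurable_toBaire (hK.union hL).compl]
    refine measure_mono_null (t := (toBaire ⁻¹' A \ toBaire ⁻¹' K) ∪
      ((toBaire ⁻¹' A)ᶜ \ toBaire ⁻¹' L)) (fun x hx => ?_) (measure_union_null hK0 hL0)
    by_cases hxA : toBaire x ∈ A
    · exact Or.inl ⟨hxA, fun h1 => hx (Or.inl h1)⟩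
    · exact Or.inr ⟨hxA, fun h1 => hx (Or.inr h1)⟩

theorem aemeasurable_baire {β : Type*} [MeasurableSpace β] [MeasurableSpace.CountablyGenerated β]
    [Nonempty β] {f : BaireSpaceOf G → β} (hf : Measurable (f ∘ toBaire : G → β)) :
    AEMeasurable f (m.map toBaire) :=
  NullMeasurable.aemeasurable fun _ hs => nullMeasurableSet_baire m (hf hs)

/-- By compactness, continuous real functions on `G × G` are measurable for the product of the Borel
`σ`-algebras, and such functions determine the Baire sets. -/
theorem measurable_inv_mul_baire :
    Measurable fun p : G × G => (toBaire (p.2⁻¹ * p.1) : BaireSpaceOf G) :=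
  measurable_toBaire_comp (q := fun p : G × G => p.2⁻¹ * p.1) fun f hf => by
    have hc : Continuous (f ∘ fun p : G × G => p.2⁻¹ * p.1) := by fun_prop
    exact (HasCompactSupport.stronglyMeasurable_of_prod hc
      (HasCompactSupport.of_compactSpace _)).measurable

/-- For fixed `s` the map `t ↦ s⁻¹t` preserves `m`. Knowing the image measure allows composition
with functions that are only almost everywhere Baire measurable. -/
theorem map_inv_mul_baire (ρ : Measure G) [IsFiniteMeasure ρ] :
    (m.prod ρ).map (fun p : G × G => (toBaire (p.2⁻¹ * p.1) : BaireSpaceOf G)) =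
      ρ univ • m.map toBaire := by
  ext s hs
  rw [Measure.map_apply measurable_inv_mul_baire hs,
    Measure.prod_apply_symm (measurable_inv_mul_baire hs), Measure.smul_apply,
    Measure.map_apply measurable_toBaire hs]
  have h : ∀ y : G, m ((fun x : G => (x, y)) ⁻¹' ((fun p : G × G =>
      (toBaire (p.2⁻¹ * p.1) : BaireSpaceOf G)) ⁻¹' s)) = m (toBaire ⁻¹' s) := fun y =>
    measure_preimage_mul m y⁻¹ (toBaire ⁻¹' s)
  simp only [h, lintegral_const, smul_eq_mul, mul_comm]

variable {m} (ρ : Measure G) [IsFiniteMeasure ρ]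

theorem aemeasurable_inv_mul {β : Type*} [MeasurableSpace β]
    [MeasurableSpace.CountablyGenerated β] [Nonempty β] {f : G → β} (hf : Measurable f) :
    AEMeasurable (fun p : G × G => f (p.2⁻¹ * p.1)) (m.prod ρ) := by
  have h := (aemeasurable_baire m (f := f) hf).smul_measure (ρ univ)
  rw [← map_inv_mul_baire m ρ] at h
  exact h.comp_measurable measurable_inv_mul_baire

/-- Tonelli's theorem for convolutions. The map `(t, s) ↦ s⁻¹ t` need not be measurable with
respect to the product of the Borel `σ`-algebras. -/
theorem lintegral_inv_mul {g : G → ℝ≥0∞} (hg : Measurable g) :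
    ∫⁻ p, g (p.2⁻¹ * p.1) ∂(m.prod ρ) = ρ univ * ∫⁻ x, g x ∂m := by
  obtain ⟨g', hg'⟩ : ∃ g' : BaireSpaceOf G → ℝ≥0∞, g' ∘ toBaire = g := ⟨g, rfl⟩
  subst hg'
  have h := (aemeasurable_baire m hg).smul_measure (ρ univ)
  rw [← map_inv_mul_baire m ρ] at h
  have h1 := lintegral_map' h measurable_inv_mul_baire.aemeasurable
  rw [map_inv_mul_baire, lintegral_smul_measure,
    lintegral_map' (aemeasurable_baire m hg) measurable_toBaire.aemeasurable] at h1
  exact h1.symm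

theorem integrable_inv_mul {f : G → ℂ} (hf : Measurable f) (hfi : Integrable f m) :
    Integrable (fun p : G × G => f (p.2⁻¹ * p.1)) (m.prod ρ) := by
  refine ⟨(aemeasurable_inv_mul ρ hf).aestronglyMeasurable, ?_⟩
  have h := lintegral_inv_mul (m := m) ρ hf.enorm
  exact h.trans_lt (ENNReal.mul_lt_top (measure_lt_top _ _) hfi.2)

/-- Tonelli's theorem for `|f - g|`; it makes the class of `μ * f` depend only on the class of `f`.
-/
theorem ae_ae_eq_inv_mul {f g : G → ℂ} (hf : Measurable f) (hg : Measurable g) (h : f =ᵐ[m] g) :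
    ∀ᵐ t ∂m, ∀ᵐ s ∂ρ, f (s⁻¹ * t) = g (s⁻¹ * t) := by
  have h0 := lintegral_inv_mul (m := m) ρ (hf.sub hg).enorm
  have h1 : ∫⁻ x, ‖(f - g) x‖ₑ ∂m = 0 := by
    rw [lintegral_congr_ae (g := fun _ => 0) (h.mono fun x hx => by simp [hx])]; simp
  rw [h1, mul_zero, lintegral_eq_zero_iff' (aemeasurable_inv_mul ρ (hf.sub hg).enorm)] at h0
  filter_upwards [Measure.ae_ae_of_ae_prod h0] with t ht
  filter_upwards [ht] with s hs
  exact sub_eq_zero.1 (enorm_eq_zero.1 hs)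

end Baire

/-! ### The convolution operator on `L^Φ(G)`. -/

section ConvolutionOperator

variable {G : Type*} [TopologicalSpace G] [MeasurableSpace G] [BorelSpace G] [Group G]
  [IsTopologicalGroup G] [CompactSpace G] {m : Measure G}
  [m.IsMulLeftInvariant] [m.InnerRegularCompactLTTop] [IsFiniteMeasure m] (μ : ComplexMeasure G)
  {Φ : YoungFunction}

theorem ae_integrable_inv_mul {f : G → ℂ} (hf : Measurable f) (hfi : Integrable f m) :
    ∀ᵐ t ∂m, μ.Integrable fun s => f (s⁻¹ * t) := by
  have := isFiniteMeasure_variation μ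
  exact (integrable_inv_mul μ.variation hf hfi).prod_right_ae

/-- Fubini's theorem with `dμ = h d|μ|`, followed by left invariance of `m`. The integral identity
is the source of injectivity. -/
theorem integrable_conv_and_integral_conv {f : G → ℂ} (hf : Measurable f) (hfi : Integrable f m) :
    Integrable (conv μ f) m ∧ ∫ t, conv μ f t ∂m = μ univ * ∫ t, f t ∂m := by
  have := isFiniteMeasure_variation μ
  obtain ⟨h, hm, hi, hn, hμ⟩ := exists_polar μ
  have h1 : Integrable (fun p : G × G => f (p.2⁻¹ * p.1) * h p.2) (m.prod μ.variation) :=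
    (integrable_inv_mul μ.variation hf hfi).mul_bdd (c := 1)
      (hm.comp measurable_snd).aestronglyMeasurable (Eventually.of_forall fun p => (hn p.2).le)
  have hae : (fun t => ∫ s, f (s⁻¹ * t) * h s ∂μ.variation) =ᵐ[m] conv μ f :=
    (ae_integrable_inv_mul μ hf hfi).mono fun t ht => (integral_eq_integral_mul hi hn hμ ht).symm
  refine ⟨h1.integral_prod_left.congr hae, ?_⟩
  rw [← integral_congr_ae hae, integral_integral_swap h1]
  have h2 : ∀ s, ∫ t, f (s⁻¹ * t) * h s ∂m = h s * ∫ t, f t ∂m := fun s => by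
    rw [MeasureTheory.integral_mul_const, integral_mul_left_eq_self f s⁻¹, mul_comm]
  have h3 : μ univ = ∫ s, h s ∂μ.variation := by
    rw [← setIntegral_univ, ← withDensityᵥ_apply hi .univ, hμ]
  simp only [h2]
  rw [MeasureTheory.integral_mul_const, h3]

theorem conv_congr {f g : G → ℂ} (hf : Measurable f) (hg : Measurable g) (h : f =ᵐ[m] g) :
    conv μ f =ᵐ[m] conv μ g := by
  have := isFiniteMeasure_variation μ
  filter_upwards [ae_ae_eq_inv_mul μ.variation hf hg h] with t ht
  exact VectorMeasure.integral_congr_ae ht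

/-- Jensen's inequality is applied to `s ↦ f(s⁻¹t)` and `|μ|` for almost every `t`, then integrated
in `t` by Tonelli's theorem. The common factor `|μ|(G)` cancels. -/
theorem modular_conv_le (hμ : μ.variation univ ≠ 0) {f : G → ℂ} (hf : Measurable f)
    (hfi : Integrable f m) (k : ℝ≥0) :
    modular Φ m (conv μ f) ((μ.variation univ).toNNReal * k) ≤ modular Φ m f k := by
  have := isFiniteMeasure_variation μ
  set ρ := μ.variation with hρ
  have hg : Measurable fun x => (Φ (‖f x‖₊ / k) : ℝ≥0∞) :=
    (Φ.measurable.comp (hf.nnnorm.div_const k)).coe_nnreal_ennreal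
  have h1 : ∀ᵐ t ∂m, (Φ (‖conv μ f t‖₊ / ((ρ univ).toNNReal * k)) : ℝ≥0∞) * ρ univ ≤
      ∫⁻ s, (Φ (‖f (s⁻¹ * t)‖₊ / k) : ℝ≥0∞) ∂ρ := by
    filter_upwards [ae_integrable_inv_mul μ hf hfi] with t ht
    refine le_trans ?_ (Φ.mul_measure_le_lintegral ρ ht k)
    gcongr
    refine Φ.mono ?_
    gcongr
    rw [← norm_toNNReal]
    refine Real.toNNReal_le_toNNReal ?_
    refine VectorMeasure.norm_integral_le_integral_norm.trans ?_
    refine mul_le_of_le_one_left (integral_nonneg fun _ => norm_nonneg _) ?_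
    exact ContinuousLinearMap.opNorm_mul_le ℝ ℂ
  have h2 : modular Φ m (conv μ f) ((ρ univ).toNNReal * k) * ρ univ ≤
      modular Φ m f k * ρ univ := by
    calc modular Φ m (conv μ f) ((ρ univ).toNNReal * k) * ρ univ
        = ∫⁻ t, (Φ (‖conv μ f t‖₊ / ((ρ univ).toNNReal * k)) : ℝ≥0∞) * ρ univ ∂m :=
          (lintegral_mul_const' _ _ (measure_ne_top _ _)).symm
      _ ≤ ∫⁻ t, ∫⁻ s, (Φ (‖f (s⁻¹ * t)‖₊ / k) : ℝ≥0∞) ∂ρ ∂m := lintegral_mono_ae h1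
      _ = modular Φ m f k * ρ univ := by
          rw [mul_comm, modular, ← lintegral_inv_mul ρ hg,
            lintegral_prod _ (aemeasurable_inv_mul ρ hg)]
  exact (ENNReal.mul_le_mul_iff_left hμ (measure_ne_top _ _)).1 h2

theorem luxemburg_conv_le (hμ : μ.variation univ ≠ 0) {f : G → ℂ} (hf : Measurable f)
    (hfi : Integrable f m) :
    luxemburg Φ m (conv μ f) ≤ μ.variation univ * luxemburg Φ m f := by
  have := isFiniteMeasure_variation μ
  have hM : μ.variation univ = ((μ.variation univ).toNNReal : ℝ≥0∞) :=
    (ENNReal.coe_toNNReal (measure_ne_top _ _)).symm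
  have hM0 : 0 < (μ.variation univ).toNNReal :=
    ENNReal.toNNReal_pos hμ (measure_ne_top _ _)
  simp only [luxemburg, ENNReal.mul_iInf_of_ne hμ (measure_ne_top _ _)]
  refine le_iInf₂ fun k hk => ?_
  refine (luxemburg_le (Φ := Φ) (m := m) (mul_pos hM0 hk.1)
    ((modular_conv_le μ hμ hf hfi k).trans hk.2)).trans_eq ?_
  rw [ENNReal.coe_mul, ← hM]

theorem luxemburg_conv_lt_top (hμ : μ.variation univ ≠ 0) (f : Orlicz Φ m) :
    luxemburg Φ m (conv μ f) < ∞ := by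
  have := isFiniteMeasure_variation μ
  exact (luxemburg_conv_le μ hμ f.measurable f.integrable).trans_lt
    (ENNReal.mul_lt_top (measure_lt_top _ _) f.luxemburg_lt_top)

/-- Convolution with `μ` as an operator on the Orlicz space. -/
noncomputable def convOperator (hμ : μ.variation univ ≠ 0) : Orlicz Φ m →L[ℂ] Orlicz Φ m :=
  LinearMap.mkContinuous
    { toFun := fun f => Orlicz.mk (conv μ f)
        (integrable_conv_and_integral_conv μ f.measurable f.integrable).1.1
        (luxemburg_conv_lt_top μ hμ f)
      map_add' := fun f g => by
        refine Orlicz.ext ((Orlicz.coeFn_mk _ _ _).trans (EventuallyEq.trans ?_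
          (Orlicz.coeFn_add _ _).symm))
        refine (conv_congr μ (f + g).measurable (f.measurable.add g.measurable)
          (Orlicz.coeFn_add f g)).trans ?_
        filter_upwards [ae_integrable_inv_mul μ f.measurable f.integrable,
          ae_integrable_inv_mul μ g.measurable g.integrable,
          Orlicz.coeFn_mk (Φ := Φ) (conv μ f)
            (integrable_conv_and_integral_conv μ f.measurable f.integrable).1.1
            (luxemburg_conv_lt_top μ hμ f),
          Orlicz.coeFn_mk (Φ := Φ) (conv μ g)
            (integrable_conv_and_integral_conv μ g.measurable g.integrable).1.1
            (luxemburg_conv_lt_top μ hμ g)] with t h1 h2 h3 h4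
        rw [h3, h4]
        exact VectorMeasure.integral_fun_add h1 h2
      map_smul' := fun c f => by
        refine Orlicz.ext ((Orlicz.coeFn_mk _ _ _).trans (EventuallyEq.trans ?_
          (Orlicz.coeFn_smul _ _).symm))
        refine (conv_congr μ (c • f).measurable (f.measurable.const_mul c)
          (Orlicz.coeFn_smul c f)).trans ?_
        filter_upwards [Orlicz.coeFn_mk (Φ := Φ) (conv μ f)
            (integrable_conv_and_integral_conv μ f.measurable f.integrable).1.1
            (luxemburg_conv_lt_top μ hμ f)] with t h1
        rw [RingHom.id_apply, h1]
        exact integral_const_mul μ c _ }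
    (μ.variation.real univ) fun f => by
      have := isFiniteMeasure_variation μ
      have h := luxemburg_conv_le (Φ := Φ) μ hμ f.measurable f.integrable
      have h1 := ENNReal.toReal_mono (ENNReal.mul_ne_top (measure_ne_top _ _)
        f.luxemburg_lt_top.ne) h
      rw [ENNReal.toReal_mul, ← luxemburg_congr (Orlicz.coeFn_mk (Φ := Φ) (conv μ f)
            (integrable_conv_and_integral_conv μ f.measurable f.integrable).1.1
            (luxemburg_conv_lt_top μ hμ f))] at h1
      exact h1

theorem coeFn_convOperator (hμ : μ.variation univ ≠ 0) (f : Orlicz Φ m) :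
    convOperator μ hμ f =ᵐ[m] conv μ f :=
  Orlicz.coeFn_mk _ _ (luxemburg_conv_lt_top μ hμ f)

theorem norm_convOperator_le (hμ : μ.variation univ ≠ 0) :
    ‖(convOperator μ hμ : Orlicz Φ m →L[ℂ] Orlicz Φ m)‖ ≤ μ.variation.real univ :=
  LinearMap.mkContinuous_norm_le _ measureReal_nonneg _

theorem isConvolutionOperator_convOperator (hμ : μ.variation univ ≠ 0) :
    IsConvolutionOperator μ (convOperator μ hμ : Orlicz Φ m →L[ℂ] Orlicz Φ m) := fun f =>
  ⟨ae_integrable_inv_mul μ f.measurable f.integrable, coeFn_convOperator μ hμ f⟩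

/-- Integrating `μ * χ_A = 0` over `G` gives `μ(G) m(A) = 0`. -/
theorem measure_eq_zero_of_convOperator_chi (hμ : μ.variation univ ≠ 0) (hμG : μ univ ≠ 0)
    {A : Set G} (hA : MeasurableSet A) (h : convOperator μ hμ (Orlicz.chi Φ m A hA) = 0) :
    m A = 0 := by
  have h1 := (integrable_conv_and_integral_conv μ (Orlicz.chi Φ m A hA).measurable
    (Orlicz.chi Φ m A hA).integrable).2
  rw [← integral_congr_ae (coeFn_convOperator μ hμ (Orlicz.chi Φ m A hA)), h,
    integral_congr_ae Orlicz.coeFn_zero, integral_congr_ae (Orlicz.coeFn_chi A hA),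
    integral_indicator hA] at h1
  simpa [hμG, measureReal_eq_zero_iff] using h1

/-- Constants are eigenvectors with eigenvalue `μ(G)`, which yields the lower bound for the norm of
the inclusion. -/
theorem convOperator_chi_univ (hμ : μ.variation univ ≠ 0) :
    convOperator μ hμ (Orlicz.chi Φ m univ .univ) = μ univ • Orlicz.chi Φ m univ .univ := by
  have := isFiniteMeasure_variation μ
  refine Orlicz.ext ?_
  have h1 : Orlicz.chi Φ m univ .univ =ᵐ[m] fun _ => (1 : ℂ) :=
    (Orlicz.coeFn_chi _ _).trans (by simp)
  filter_upwards [coeFn_convOperator μ hμ (Orlicz.chi Φ m univ .univ),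
    conv_congr μ (Orlicz.chi Φ m univ .univ).measurable measurable_const h1,
    Orlicz.coeFn_smul (μ univ) (Orlicz.chi Φ m univ .univ), h1] with t h2 h3 h4 h5
  rw [h2, h3, h4, h5, conv, VectorMeasure.integral_const]
  simp

end ConvolutionOperator

theorem Orlicz.norm_chi_univ_pos {α : Type*} [MeasurableSpace α] {m : Measure α}
    [IsFiniteMeasure m] [NeZero m] (Φ : YoungFunction) : 0 < ‖chi Φ m univ .univ‖ := by
  refine norm_pos_iff.2 fun h => ?_
  have h1 := coeFn_chi (Φ := Φ) (m := m) univ .univ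
  rw [h] at h1
  obtain ⟨x, hx, hx'⟩ := (h1.and coeFn_zero).exists
  rw [hx] at hx'
  simp at hx'

end OrliczConv

theorem mainTheorem9 {G : Type*} [Group G] [TopologicalSpace G] [IsTopologicalGroup G]
    [CompactSpace G] [T2Space G] [MeasurableSpace G] [BorelSpace G]
    (m : Measure G) [m.IsHaarMeasure] [m.Regular] [IsProbabilityMeasure m]
    (Φ : OrliczConv.YoungFunction) (hΦ : Φ.DeltaTwo)
    (μ : ComplexMeasure G) (hμ : μ.variation.Regular) (hμG : μ univ ≠ 0) :
    ∃ (T : OrliczConv.Orlicz Φ m →L[ℂ] OrliczConv.Orlicz Φ m)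
      (ν : VectorMeasure G (OrliczConv.Orlicz Φ m)),
      OrliczConv.IsConvolutionOperator μ T ∧
      OrliczConv.IsAssociatedMeasure T ν ∧
      (∀ f : OrliczConv.Orlicz Φ m,
        OrliczConv.vNorm ν f ≤ ENNReal.ofReal (‖f‖ * μ.variation.real univ)) ∧
      ∃ ι : OrliczConv.Orlicz Φ m →L[ℂ] OrliczConv.VL1 ν,
        OrliczConv.IsInclusion ν ι ∧ ‖μ univ‖ ≤ ‖ι‖ ∧ ‖ι‖ ≤ μ.variation.real univ := by
  have hμ0 : μ.variation univ ≠ 0 := fun h0 => hμG <| by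
    have h := VectorMeasure.enorm_measure_le_variation μ univ
    rw [h0] at h
    exact enorm_eq_zero.1 (le_antisymm h zero_le)
  have hν := OrliczConv.assocMeasure_apply hΦ
    (OrliczConv.convOperator μ hμ0 : OrliczConv.Orlicz Φ m →L[ℂ] OrliczConv.Orlicz Φ m)
  have hT := OrliczConv.norm_convOperator_le (m := m) (Φ := Φ) μ hμ0
  refine ⟨OrliczConv.convOperator μ hμ0, OrliczConv.assocMeasure hΦ (OrliczConv.convOperator μ hμ0),
    OrliczConv.isConvolutionOperator_convOperator μ hμ0, hν, fun f => ?_,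
    OrliczConv.inclusion hΦ hν, ⟨fun f g hg hgf => ?_, ?_⟩, ?_,
    (OrliczConv.norm_inclusion_le hΦ hν).trans hT⟩
  · refine (OrliczConv.vNorm_le hΦ hν f.measurable f (ae_eq_refl _)).trans ?_
    rw [mul_comm]
    gcongr
  · exact ⟨OrliczConv.isVIntegrable hΦ hν hg f hgf.symm,
      OrliczConv.inclusion_apply hΦ hν f _ hgf⟩
  · exact OrliczConv.inclusion_injective hΦ hν fun A hA =>
      OrliczConv.measure_eq_zero_of_convOperator_chi μ hμ0 hμG hA
  -- This reads `|μ(G)| ‖1‖ ≤ ‖ι‖ ‖1‖`, and `‖1‖ > 0` can be cancelled.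
  · have h := OrliczConv.norm_le_norm_inclusion hΦ hν
    rw [OrliczConv.convOperator_chi_univ, norm_smul] at h
    exact le_of_mul_le_mul_right h (OrliczConv.Orlicz.norm_chi_univ_pos Φ)
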